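/- For a finite simple graph $G=(V,E)$ and $B\subseteq V$ let $\gamma_G(B)$ be the minimum cardinality of a set $D\subseteq V$ with $B\subseteq\bigcup_{x\in D}N[x]$, where $N[x]$ is the closed neighbourhood of $x$. The independence domination number of $G$ is $\gamma^i(G)=\max\{\gamma_G(A) : A \text{ is an independent set in } G\}$. The graph $G$ is distance-hereditary if for every pair of nonadjacent vertices all the chordless (induced) paths that connect them have the same length. Theorem. There exists an algorithm (a single program for a unit-cost random access machine with words of $O(\log n)$ bits) which, given the adjacency matrix of a distance-hereditary graph $G$ with $n$ vertices, computes $\gamma^i(G)$ in time $O(n^3)$. -/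

import Mathlib

open Filter Asymptotics

namespace IndepDom

section Graphs

variable {V : Type*}

/-- The set `D` dominates the set `B`: every vertex of `B` lies in the closed neighbourhood
`N[x] = {x} ∪ N(x)` of some `x ∈ D`. -/
def Dominates (G : SimpleGraph V) (D B : Set V) : Prop :=
  B ⊆ ⋃ x ∈ D, insert x (G.neighborSet x)

/-- `γ_G(B)`: the least number of vertices of `G` needed to dominate `B`. -/
noncomputable def domNumber [Fintype V] (G : SimpleGraph V) (B : Set V) : ℕ :=
  sInf {k | ∃ D : Finset V, Dominates G (D : Set V) B ∧ D.card = k}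

/-- `γ^i(G)`: the maximum of `γ_G(A)` over the independent sets `A` of `G`. -/
noncomputable def indepDomNumber [Fintype V] (G : SimpleGraph V) : ℕ :=
  sSup {k | ∃ A : Set V, G.IsIndepSet A ∧ domNumber G A = k}

/-- Distance-hereditary graphs: for every pair of nonadjacent vertices, all the chordless
paths that connect them have the same length. -/
def IsDistanceHereditary (G : SimpleGraph V) : Prop :=
  ∀ u v : V, ¬ G.Adj u v → ∀ p q : G.Walk u v,
    p.IsPath → p.IsChordless → q.IsPath → q.IsChordless → p.length = q.length

end Graphs

/-! The machine model: structured programs on a random access machine whose words hold the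
numbers `0, …, B`.  A program mentions finitely many registers and finitely many arrays (each
a separate region of memory); every elementary operation takes one time step. -/

/-- Memory contents: registers, and arrays (given by array name and index). -/
structure State where
  reg : ℕ → ℕ
  arr : ℕ → ℕ → ℕ

/-- Put `v` into register `x`. -/
def State.setReg (s : State) (x v : ℕ) : State where
  reg := Function.update s.reg x v
  arr := s.arr

/-- Put `v` into the cell with index `i` of array `a`. -/
def State.setCell (s : State) (a i v : ℕ) : State where
  reg := s.reg
  arr := Function.update s.arr a (Function.update (s.arr a) i v)

/-- Expressions: constants, registers, array cells at a computed index, arithmetic (with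
subtraction truncated at `0`), and the comparisons `<`, `=` with value `1` or `0`. -/
inductive Expr where
  | const (c : ℕ)
  | reg (x : ℕ)
  | cell (a : ℕ) (i : Expr)
  | add (e f : Expr)
  | sub (e f : Expr)
  | mul (e f : Expr)
  | lt (e f : Expr)
  | eq (e f : Expr)

/-- The value of an expression. -/
def Expr.eval (s : State) : Expr → ℕ
  | const c => c
  | reg x => s.reg x
  | cell a i => s.arr a (i.eval s)
  | add e f => e.eval s + f.eval s
  | sub e f => e.eval s - f.eval s
  | mul e f => e.eval s * f.eval s
  | lt e f => if e.eval s < f.eval s then 1 else 0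
  | eq e f => if e.eval s = f.eval s then 1 else 0

/-- All values (array indices included) that occur when the expression is evaluated fit into
a machine word, that is, are at most `B`. -/
def Expr.Fits (B : ℕ) (s : State) : Expr → Prop
  | const c => c ≤ B
  | reg x => s.reg x ≤ B
  | cell a i => i.Fits B s ∧ s.arr a (i.eval s) ≤ B
  | add e f => e.Fits B s ∧ f.Fits B s ∧ e.eval s + f.eval s ≤ B
  | sub e f => e.Fits B s ∧ f.Fits B s
  | mul e f => e.Fits B s ∧ f.Fits B s ∧ e.eval s * f.eval s ≤ B
  | lt e f => e.Fits B s ∧ f.Fits B s ∧ 1 ≤ B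
  | eq e f => e.Fits B s ∧ f.Fits B s ∧ 1 ≤ B

/-- The number of time steps needed to evaluate an expression: one for each operation,
constant and memory access in it. -/
def Expr.cost : Expr → ℕ
  | const _ => 1
  | reg _ => 1
  | cell _ i => i.cost + 1
  | add e f => e.cost + f.cost + 1
  | sub e f => e.cost + f.cost + 1
  | mul e f => e.cost + f.cost + 1
  | lt e f => e.cost + f.cost + 1
  | eq e f => e.cost + f.cost + 1

/-- Programs: `assign x e` puts the value of `e` into register `x`, and `write a i e` puts it
into the cell of array `a` at the index given by `i`; a test succeeds if its value is not `0`. -/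
inductive Prog where
  | skip
  | assign (x : ℕ) (e : Expr)
  | write (a : ℕ) (i e : Expr)
  | seq (p q : Prog)
  | ite (e : Expr) (p q : Prog)
  | loop (e : Expr) (p : Prog)

/-- `Prog.Runs B p s t s'`: on a machine with words `0, …, B`, the program `p` started in
state `s` halts in state `s'` after exactly `t` steps, without overflow.  Here `loop e p` means
"while `e` is not `0`, do `p`". -/
inductive Prog.Runs (B : ℕ) : Prog → State → ℕ → State → Prop
  | skip (s : State) : Runs B .skip s 1 s
  | assign (s : State) (x : ℕ) (e : Expr) (he : e.Fits B s) :
      Runs B (.assign x e) s (e.cost + 1)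
        (s.setReg x (e.eval s))
  | write (s : State) (a : ℕ) (i e : Expr) (hi : i.Fits B s) (he : e.Fits B s) :
      Runs B (.write a i e) s (i.cost + e.cost + 1)
        (s.setCell a (i.eval s) (e.eval s))
  | seq {p q : Prog} {s s' s'' : State} {t t' : ℕ}
      (hp : Runs B p s t s') (hq : Runs B q s' t' s'') :
      Runs B (.seq p q) s (t + t') s''
  | ite_true {e : Expr} {p : Prog} (q : Prog) {s s' : State} {t : ℕ}
      (he : e.Fits B s) (h : e.eval s ≠ 0) (hp : Runs B p s t s') :
      Runs B (.ite e p q) s (e.cost + 1 + t) s'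
  | ite_false {e : Expr} (p : Prog) {q : Prog} {s s' : State} {t : ℕ}
      (he : e.Fits B s) (h : e.eval s = 0) (hq : Runs B q s t s') :
      Runs B (.ite e p q) s (e.cost + 1 + t) s'
  | loop_stop {e : Expr} (p : Prog) {s : State}
      (he : e.Fits B s) (h : e.eval s = 0) :
      Runs B (.loop e p) s (e.cost + 1) s
  | loop_step {e : Expr} {p : Prog} {s s' s'' : State} {t t' : ℕ}
      (he : e.Fits B s) (h : e.eval s ≠ 0)
      (hp : Runs B p s t s') (hl : Runs B (.loop e p) s' t' s'') :
      Runs B (.loop e p) s (e.cost + 1 + t + t') s''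

open Classical in
/-- The memory at the start: register `0` holds the number `n` of vertices, array `0` holds the
adjacency matrix of `G` row by row, and everything else is `0`. -/
noncomputable def input {n : ℕ} (G : SimpleGraph (Fin n)) : State where
  reg x := if x = 0 then n else 0
  arr a k := if a = 0 ∧ ∃ i j : Fin n, G.Adj i j ∧ k = (i : ℕ) * n + (j : ℕ) then 1 else 0

end IndepDom

namespace IndepDom

/-! ### Shortest walks in distance-hereditary graphs. -/

section Graphs

variable {V : Type*} {G : SimpleGraph V}

/-! A greedy packing of disjoint closed neighbourhoods turns out to be optimal. Arrange the vertices
in levels by breadth-first search, each new component starting with a root alone on the next level.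
Go through the vertices from the highest level down, within a level by increasing number of parents,
and pick a vertex whenever its closed neighbourhood misses those of all vertices picked before. Let
`P` be the set of picked vertices.

Lower bound: `P` is independent, and no vertex dominates two of its members, so dominating `P` takes
`P.card` vertices.

Upper bound: let `A` be independent. Every `x` in `A` comes after some `p` in `P` whose closed
neighbourhood meets that of `x`. It therefore suffices that the members of `A` charged to one `p`
have a common dominator (`IsLayering.exists_dominator`). This rests on
`IsLayering.parent_or_forall_adj`: such an `x` is a parent of `p` or adjacent to all parents of `p`.
If one of them is a parent of `p`, independence rules out the second alternative for all of them,
and `p` dominates them; otherwise any parent of `p` does. A vertex without parents can be charged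
only with itself.

Distance heredity enters through one fact: a walk contains enough vertices to build a shortest path
between its ends. Hence vertices of one level joined by a walk that never goes lower have the same
parents (`IsLayering.parent_of_walk`), and parent sets with a common element are nested
(`IsLayering.parents_nested`).

For the running time, each of `n` rounds of the level construction scans all pairs of vertices, and
each of `n` rounds of the selection blocks vertices by another scan of all pairs. All numbers that
occur are at most `(n + 2) ^ 2`. -/

theorem isPath_and_isChordless_of_length_le {S : Set V} {u v : V} (p : G.Walk u v)
    (hp : ∀ z ∈ p.support, z ∈ S)
    (hmin : ∀ q : G.Walk u v, (∀ z ∈ q.support, z ∈ S) → p.length ≤ q.length) :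
    p.IsPath ∧ p.IsChordless := by
  classical
  constructor
  · have : p.bypass = p := p.bypass_eq_self_of_length_le_length_bypass
      (hmin _ fun z hz => hp z (p.support_bypass_subset_support hz))
    rw [← this]
    exact p.bypass_isPath
  · rw [SimpleGraph.Walk.isChordless_iff_forall_mem_edges]
    have key : ∀ i j, i < j → j ≤ p.length → G.Adj (p.getVert i) (p.getVert j) →
        s(p.getVert i, p.getVert j) ∈ p.edges := by
      intro i j hij hj hadj
      -- A chord from position `i` to position `j` gives a shortcut that stays in `S`; minimality
      -- leaves only `j = i + 1`, an edge of the walk.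
      have h := hmin ((p.take i).append (.cons hadj (p.drop j))) (by
        intro z hz
        rw [SimpleGraph.Walk.mem_support_append_iff, SimpleGraph.Walk.support_cons,
          List.mem_cons] at hz
        rcases hz with hz | rfl | hz
        · exact hp z ((p.isSubwalk_take i).support_subset hz)
        · exact hp _ (p.getVert_mem_support i)
        · exact hp z ((p.isSubwalk_drop j).support_subset hz))
      simp only [SimpleGraph.Walk.length_append, SimpleGraph.Walk.length_cons,
        SimpleGraph.Walk.take_length, SimpleGraph.Walk.drop_length] at h
      obtain rfl : j = i + 1 := by omega
      rw [← SimpleGraph.Walk.mem_edges_toSubgraph]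
      exact p.toSubgraph_adj_getVert (by omega)
    intro a b ha hb hab
    obtain ⟨i, rfl, hi⟩ := SimpleGraph.Walk.mem_support_iff_exists_getVert.1 ha
    obtain ⟨j, rfl, hj⟩ := SimpleGraph.Walk.mem_support_iff_exists_getVert.1 hb
    rcases lt_trichotomy i j with h | rfl | h
    · exact key i j h hj hab
    · exact absurd hab (G.loopless.irrefl _)
    · rw [Sym2.eq_swap]
      exact key j i h hi hab.symm

/-- In a distance-hereditary graph, a connected set of vertices contains shortest paths. -/
theorem IsDistanceHereditary.exists_walk_length_eq_dist (hG : IsDistanceHereditary G)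
    {S : Set V} {u v : V} (p : G.Walk u v) (hp : ∀ z ∈ p.support, z ∈ S) :
    ∃ q : G.Walk u v, (∀ z ∈ q.support, z ∈ S) ∧ q.length = G.dist u v := by
  classical
  by_cases hadj : G.Adj u v
  · refine ⟨.cons hadj .nil, ?_, ?_⟩
    · intro z hz
      simp only [SimpleGraph.Walk.support_cons, SimpleGraph.Walk.support_nil, List.mem_cons,
        List.not_mem_nil, or_false] at hz
      rcases hz with rfl | rfl
      · exact hp _ p.start_mem_support
      · exact hp _ p.end_mem_support
    · simpa using (SimpleGraph.dist_eq_one_iff_adj.2 hadj).symm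
  -- A shortest walk inside `S` is chordless in all of `G`, since a chord would have both ends in
  -- `S`. It therefore has the same length as a shortest walk of `G`.
  · have hex : ∃ k, ∃ q : G.Walk u v, (∀ z ∈ q.support, z ∈ S) ∧ q.length = k := ⟨_, p, hp, rfl⟩
    obtain ⟨q, hq, hqk⟩ := Nat.find_spec hex
    have h1 := isPath_and_isChordless_of_length_le q hq
      fun q' hq' => hqk ▸ Nat.find_min' hex ⟨q', hq', rfl⟩
    obtain ⟨g, hg⟩ := p.reachable.exists_walk_length_eq_dist
    have h2 := isPath_and_isChordless_of_length_le (S := Set.univ) g (fun _ _ => trivial)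
      fun q' _ => hg ▸ SimpleGraph.dist_le q'
    exact ⟨q, hq, (hG u v hadj q g h1.1 h1.2 h2.1 h2.2).trans hg⟩

/-- The vertices of `p` carry a walk of length `G.dist u v`, which is two here; its middle vertex is
the one wanted. This is how forbidden configurations are excluded below: exhibit a walk none of
whose vertices can be a common neighbour. -/
theorem IsDistanceHereditary.exists_common_neighbor (hG : IsDistanceHereditary G)
    {u v m : V} (hum : G.Adj u m) (hmv : G.Adj m v) (huv : ¬ G.Adj u v) (hne : u ≠ v)
    (p : G.Walk u v) : ∃ c ∈ p.support, G.Adj u c ∧ G.Adj c v := by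
  obtain ⟨q, hq, hl⟩ := hG.exists_walk_length_eq_dist (S := {z | z ∈ p.support}) p fun _ h => h
  have h2 : G.dist u v ≤ 2 := SimpleGraph.dist_le (.cons hum (.cons hmv .nil))
  match q, hq, hl with
  | .nil, _, _ => exact absurd rfl hne
  | .cons h .nil, _, _ => exact absurd h huv
  | .cons (v := c) h (.cons h' .nil), hq, _ => exact ⟨c, hq c (by simp), h, h'⟩
  | .cons _ (.cons _ (.cons _ _)), _, hl =>
    simp only [SimpleGraph.Walk.length_cons] at hl
    omega

/-! ### Levels and parents. -/

/-- `m` lies in the closed neighbourhood of `x`. -/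
def ClosedAdj (G : SimpleGraph V) (m x : V) : Prop := m = x ∨ G.Adj m x

/-- `u` is a neighbour of `x` on the previous level of `D`. -/
def Parent (G : SimpleGraph V) (D : V → ℕ) (u x : V) : Prop :=
  G.Adj u x ∧ D x = D u + 1

/-- `D` arranges the vertices in levels, as breadth-first searches of the components
one after another do. -/
structure IsLayering (G : SimpleGraph V) (D : V → ℕ) : Prop where
  le_succ : ∀ u w, G.Adj u w → D w ≤ D u + 1
  parent_or_unique : ∀ x, (∃ u, Parent G D u x) ∨ ∀ y, D y = D x → y = x

namespace IsLayering

variable {D : V → ℕ}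

theorem le_add_length (hD : IsLayering G D) {u v : V} (p : G.Walk u v) :
    D u ≤ D v + p.length := by
  induction p with
  | nil => simp
  | cons h p ih =>
    have := hD.le_succ _ _ h.symm
    simp only [SimpleGraph.Walk.length_cons]
    omega

/-- Descend from parent to parent until the first level that consists of a single vertex. On the
levels passed every vertex has a parent, so all of them descend to that same vertex `r`, and by
`le_add_length` these descents are shortest paths. -/
theorem exists_apex (hD : IsLayering G D) (x : V) :
    ∃ r, (∀ z, D z = D r → z = r) ∧ D r ≤ D x ∧ ∀ z, D r ≤ D z → D z ≤ D x →
      ∃ p : G.Walk z r, p.length + D r = D z ∧ ∀ w ∈ p.support, w = z ∨ D w < D z := by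
  induction hk : D x generalizing x with
  | zero =>
    have hx : ∀ y, D y = D x → y = x := (hD.parent_or_unique x).resolve_left
      fun ⟨u, hu⟩ => by have := hu.2; omega
    refine ⟨x, hx, by omega, fun z _ hz => ?_⟩
    obtain rfl := hx z (by omega)
    exact ⟨.nil, by simp⟩
  | succ k ih =>
    by_cases hall : ∃ y, D y = k + 1 ∧ ∀ z, D z = D y → z = y
    · obtain ⟨y, hy, hu⟩ := hall
      refine ⟨y, hu, by omega, fun z _ hz => ?_⟩
      obtain rfl := hu z (by omega)
      exact ⟨.nil, by simp⟩
    · have hpar : ∀ y, D y = k + 1 → ∃ u, Parent G D u y := fun y hy =>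
        (hD.parent_or_unique y).resolve_right fun h => hall ⟨y, hy, h⟩
      obtain ⟨u, hu⟩ := hpar x hk
      obtain ⟨r, hr, hrk, hw⟩ := ih u (by have := hu.2; omega)
      refine ⟨r, hr, by omega, fun z h1 h2 => ?_⟩
      rcases Nat.lt_or_eq_of_le h2 with h2 | h2
      · exact hw z h1 (by omega)
      · obtain ⟨a, ha⟩ := hpar z h2
        have hz := ha.2
        obtain ⟨p, hp, hs⟩ := hw a (by omega) (by omega)
        refine ⟨.cons ha.1.symm p, by simp only [SimpleGraph.Walk.length_cons]; omega, ?_⟩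
        intro w hw
        rw [SimpleGraph.Walk.support_cons, List.mem_cons] at hw
        refine hw.imp_right fun hw => ?_
        rcases hs w hw with rfl | h <;> omega

/-- Two vertices of one level that are connected without going below their level have the
same parents. -/
theorem parent_of_walk (hD : IsLayering G D) (hG : IsDistanceHereditary G) {x y u : V}
    (hxy : D y = D x) (p : G.Walk x y) (hp : ∀ z ∈ p.support, D x ≤ D z)
    (hu : Parent G D u x) : Parent G D u y := by
  obtain ⟨r, hr, hrx, hw⟩ := hD.exists_apex x
  have hux := hu.2
  rcases Nat.lt_or_eq_of_le hrx with hlt | heq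
  · obtain ⟨a, ha, has⟩ := hw u (by omega) (by omega)
    obtain ⟨b, hb, -⟩ := hw y (by omega) (by omega)
    -- Walk from `y` back to `x`, on to `u`, and down to the apex. Heredity gives a shortest walk
    -- from `y` to `r` using only vertices not below the level of `x` and vertices of the descent
    -- from `u`.
    obtain ⟨q, hq, hql⟩ := hG.exists_walk_length_eq_dist
      (S := {z | D x ≤ D z ∨ z ∈ a.support}) ((p.reverse.append (.cons hu.1.symm a))) (by
        intro z hz
        rw [SimpleGraph.Walk.mem_support_append_iff, SimpleGraph.Walk.support_cons,
          List.mem_cons, SimpleGraph.Walk.support_reverse, List.mem_reverse] at hz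
        rcases hz with hz | rfl | hz
        · exact Or.inl (hp z hz)
        · exact Or.inl le_rfl
        · exact Or.inr hz)
    have hlen := SimpleGraph.dist_le b
    match q, hq, hql with
    | .nil, _, _ => omega
    | .cons (v := c) h q', hq, hl =>
      simp only [SimpleGraph.Walk.length_cons] at hl
      -- A shortest walk must go down in its first step, and the only vertex of the descent just one
      -- level below `y` is `u`.
      have h1 := hD.le_add_length q'
      have h2 := hD.le_succ _ _ h.symm
      rcases hq c (by simp) with h3 | h3
      · change D x ≤ D c at h3
        omega
      · rcases has c h3 with rfl | h4
        · exact ⟨h.symm, by omega⟩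
        · omega
  · obtain rfl := hr x heq.symm
    obtain rfl := hr y hxy
    exact hu

theorem parent_of_adj (hD : IsLayering G D) (hG : IsDistanceHereditary G) {x y u : V}
    (hxy : D y = D x) (h : G.Adj x y) (hu : Parent G D u x) : Parent G D u y :=
  hD.parent_of_walk hG hxy (.cons h .nil) (by simp [hxy]) hu

theorem parent_of_adj_adj (hD : IsLayering G D) (hG : IsDistanceHereditary G) {x m y u : V}
    (hxy : D y = D x) (h : G.Adj x m) (h' : G.Adj m y) (hm : D x ≤ D m) (hu : Parent G D u x) :
    Parent G D u y :=
  hD.parent_of_walk hG hxy (.cons h (.cons h' .nil)) (by simp [hxy, hm]) hu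

/-- If `a` has a parent `p`, then `p` is also a parent of `w` and `b`. The walk `a, x, w, y, b` must
contain a common neighbour of `a` and `b`, which can only be `w`. But then `x` and `b` have the
common neighbour `w`, while the walk `x, a, p, b` contains none. If `a` has no parent, it is alone
on its level and equals `w`. -/
theorem parents_nested (hD : IsLayering G D) (hG : IsDistanceHereditary G) {x y w a b : V}
    (hwx : Parent G D w x) (hwy : Parent G D w y) (hax : Parent G D a x) (hby : Parent G D b y)
    (hay : ¬ Parent G D a y) (hbx : ¬ Parent G D b x) : False := by
  have e1 := hwx.2
  have e2 := hwy.2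
  have e3 := hax.2
  have e4 := hby.2
  have hxy : D y = D x := by omega
  have hne : x ≠ y := by rintro rfl; exact hay hax
  have hay' : ¬ G.Adj a y := fun h => hay ⟨h, by omega⟩
  have hbx' : ¬ G.Adj b x := fun h => hbx ⟨h, by omega⟩
  have hnadj : ¬ G.Adj x y := fun h => hay (hD.parent_of_adj hG hxy h hax)
  have hab : ¬ G.Adj a b := by
    intro h
    obtain ⟨c, hc, h1, h2⟩ := hG.exists_common_neighbor hwx.1.symm hwy.1 hnadj hne
      (.cons hax.1.symm (.cons h (.cons hby.1 .nil)))
    simp only [SimpleGraph.Walk.support_cons, SimpleGraph.Walk.support_nil, List.mem_cons,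
      List.not_mem_nil, or_false] at hc
    rcases hc with rfl | rfl | rfl | rfl
    · exact h1.ne rfl
    · exact hay' h2
    · exact hbx' h1.symm
    · exact h2.ne rfl
  have hne' : a ≠ b := by rintro rfl; exact hay hby
  let W : G.Walk a b := .cons hax.1 (.cons hwx.1.symm (.cons hwy.1 (.cons hby.1.symm .nil)))
  rcases hD.parent_or_unique a with ⟨p, hp⟩ | huniq
  · have e5 := hp.2
    have hpw : Parent G D p w :=
      hD.parent_of_adj_adj hG (by omega) hax.1 hwx.1.symm (by omega) hp
    have hpb : Parent G D p b := hD.parent_of_walk hG (by omega) W (by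
      simp only [W, SimpleGraph.Walk.support_cons, SimpleGraph.Walk.support_nil, List.mem_cons,
        List.not_mem_nil, or_false]
      rintro z (rfl | rfl | rfl | rfl | rfl) <;> omega) hp
    obtain ⟨c, hc, h1, h2⟩ := hG.exists_common_neighbor hp.1.symm hpb.1 hab hne' W
    simp only [W, SimpleGraph.Walk.support_cons, SimpleGraph.Walk.support_nil, List.mem_cons,
      List.not_mem_nil, or_false] at hc
    obtain rfl : c = w := by
      rcases hc with rfl | rfl | rfl | rfl | rfl
      · exact absurd rfl h1.ne
      · exact absurd h2.symm hbx'
      · rfl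
      · exact absurd h1 hay'
      · exact absurd rfl h2.ne
    obtain ⟨d, hd, h3, h4⟩ := hG.exists_common_neighbor hwx.1.symm h2 (fun h => hbx' h.symm)
      (fun h => by subst h; omega) (.cons hax.1.symm (.cons hp.1.symm (.cons hpb.1 .nil)))
    simp only [SimpleGraph.Walk.support_cons, SimpleGraph.Walk.support_nil, List.mem_cons,
      List.not_mem_nil, or_false] at hd
    rcases hd with rfl | rfl | rfl | rfl
    · exact h3.ne rfl
    · exact hab h4
    · have := hD.le_succ _ _ h3.symm
      omega
    · exact h4.ne rfl
  · obtain rfl := huniq w (by omega)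
    exact hay hwy

/-- A parent `p` of `s` is a parent of `s'` and `z` too. The walk `v, s', p, z` must contain a
common neighbour of `v` and `z`; as `p` is two levels from `v`, it is `s'`. -/
theorem adj_of_adj_parent (hD : IsLayering G D) (hG : IsDistanceHereditary G) {v s s' z : V}
    (hs : Parent G D s v) (hs' : Parent G D s' v) (hz : D z = D s) (hzs : G.Adj s z)
    (hzv : ¬ G.Adj z v) : G.Adj s' z := by
  have e1 := hs.2
  have e2 := hs'.2
  rcases hD.parent_or_unique s with ⟨p, hp⟩ | huniq
  · have e3 := hp.2
    have hpz : Parent G D p z := hD.parent_of_adj hG hz hzs hp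
    have hps' : Parent G D p s' :=
      hD.parent_of_adj_adj hG (by omega) hs.1 hs'.1.symm (by omega) hp
    obtain ⟨c, hc, h1, h2⟩ := hG.exists_common_neighbor hs.1.symm hzs (fun h => hzv h.symm)
      (fun h => by subst h; omega) (.cons hs'.1.symm (.cons hps'.1.symm (.cons hpz.1 .nil)))
    simp only [SimpleGraph.Walk.support_cons, SimpleGraph.Walk.support_nil, List.mem_cons,
      List.not_mem_nil, or_false] at hc
    rcases hc with rfl | rfl | rfl | rfl
    · exact absurd rfl h1.ne
    · exact h2
    · have := hD.le_succ _ _ h1.symm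
      omega
    · exact absurd rfl h2.ne
  · exact absurd (huniq z hz) hzs.ne'

/-- A vertex without parents is alone on its level and all its neighbours are on higher levels, so
nothing that is not higher lies within distance two of it. -/
theorem eq_of_forall_not_parent (hD : IsLayering G D) {v x m : V} (hv : ∀ s, ¬ Parent G D s v)
    (hvx : D x ≤ D v) (hmv : ClosedAdj G m v) (hmx : ClosedAdj G m x) : x = v := by
  have hu : ∀ y, D y = D v → y = v :=
    (hD.parent_or_unique v).resolve_left fun ⟨s, hs⟩ => hv s hs
  have key : ∀ y, ClosedAdj G y v → D y ≤ D v → y = v := by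
    rintro y (rfl | h) hle
    · rfl
    · have := hD.le_succ _ _ h
      by_contra hne
      refine hv y ⟨h, ?_⟩
      have : D y ≠ D v := fun h => hne (hu y h)
      omega
  rcases hmx with rfl | hmx
  · exact key _ hmv hvx
  · by_contra hne
    have h1 := hD.le_succ _ _ hmx.symm
    have h2 : D x ≠ D v := fun h => hne (hu x h)
    obtain rfl := key m hmv (by omega)
    exact hne (key x (Or.inr hmx.symm) hvx)

end IsLayering

/-! ### The elimination order and the optimality of the greedy packing. -/

open Classical in
/-- `v` comes before `x` when vertices are ordered by decreasing level, and inside a level by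
increasing number of parents. -/
def Precedes [Fintype V] (G : SimpleGraph V) (D : V → ℕ) (v x : V) : Prop :=
  D x < D v ∨ D x = D v ∧
    (Finset.univ.filter fun u => Parent G D u v).card ≤
      (Finset.univ.filter fun u => Parent G D u x).card

namespace IsLayering

variable {D : V → ℕ} [Fintype V]

/-- The cases are the levels of `x` and of the common neighbour `m` relative to `v`. Only one needs
the order inside a level: `x` and `v` on the same level with `m` as a common parent. -/
theorem parent_or_forall_adj (hD : IsLayering G D) (hG : IsDistanceHereditary G) {v x m : V}
    (hvx : Precedes G D v x) (hmv : ClosedAdj G m v) (hmx : ClosedAdj G m x) :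
    Parent G D x v ∨ ∀ s, Parent G D s v → G.Adj s x := by
  classical
  have hle : D x ≤ D v := by rcases hvx with h | h <;> omega
  have hadj : G.Adj v x → Parent G D x v ∨ ∀ s, Parent G D s v → G.Adj s x := fun h => by
    rcases Nat.lt_or_eq_of_le hle with hlt | heq
    · exact Or.inl ⟨h.symm, le_antisymm (hD.le_succ _ _ h.symm) hlt⟩
    · exact Or.inr fun s hs => (hD.parent_of_adj hG heq h hs).1
  rcases hmv with rfl | hmv
  · rcases hmx with rfl | hmx
    · exact Or.inr fun s hs => hs.1
    · exact hadj hmx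
  rcases hmx with rfl | hmx
  · exact hadj hmv.symm
  have h1 := hD.le_succ _ _ hmv
  have h2 := hD.le_succ _ _ hmv.symm
  have h3 := hD.le_succ _ _ hmx.symm
  rcases Nat.lt_or_eq_of_le hle with hlt | heq
  · by_cases hm : D m = D v
    · exact Or.inl (hD.parent_of_adj hG hm.symm hmv ⟨hmx.symm, by omega⟩)
    have hmp : Parent G D m v := ⟨hmv, by omega⟩
    by_cases hxm : D x = D m
    · by_cases hxv : G.Adj x v
      · exact hadj hxv.symm
      · exact Or.inr fun s hs => hD.adj_of_adj_parent hG hmp hs hxm hmx hxv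
    · refine Or.inr fun s hs => ?_
      have := hs.2
      have := hD.le_succ _ _ hmx
      exact (hD.parent_of_adj_adj hG (x := m) (by omega) hmv hs.1.symm (by omega)
        ⟨hmx.symm, by omega⟩).1.symm
  · refine Or.inr fun s hs => ?_
    by_cases hm : D v ≤ D m
    · exact (hD.parent_of_adj_adj hG heq hmv.symm hmx hm hs).1
    by_contra hsx
    -- If `s` were not a parent of `x`, nestedness would make the parents of `x` a proper subset of
    -- those of `v`, against the order by number of parents.
    have hcard := (hvx.resolve_left (by omega)).2
    refine absurd hcard (not_le.2 (Finset.card_lt_card ?_))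
    rw [Finset.ssubset_iff_of_subset]
    · exact ⟨s, by simpa using hs, by simpa using fun h => hsx h.1⟩
    · intro b hb
      rw [Finset.mem_filter_univ] at hb ⊢
      by_contra hbv
      exact hD.parents_nested hG ⟨hmv, by omega⟩ ⟨hmx, by omega⟩ hs hb (fun h => hsx h.1) hbv

/-- The vertices of an independent set that come after `v` and have distance at most two from
`v` have a common dominator. -/
theorem exists_dominator (hD : IsLayering G D) (hG : IsDistanceHereditary G) {A : Set V}
    (hA : G.IsIndepSet A) (v : V)
    (h : ∀ x ∈ A, Precedes G D v x ∧ ∃ m, ClosedAdj G m v ∧ ClosedAdj G m x) :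
    ∃ d, ∀ x ∈ A, x = d ∨ G.Adj d x := by
  by_cases hv : ∃ s, Parent G D s v
  · obtain ⟨s, hs⟩ := hv
    -- If a member of `A` is a parent of `v`, no other member is adjacent to it, so all members are
    -- parents of `v`; otherwise all are adjacent to `s`.
    by_cases hp : ∃ a ∈ A, Parent G D a v
    · obtain ⟨a, haA, ha⟩ := hp
      refine ⟨v, fun x hx => ?_⟩
      obtain ⟨h1, m, h2, h3⟩ := h x hx
      rcases hD.parent_or_forall_adj hG h1 h2 h3 with h4 | h4
      · exact Or.inr h4.1.symm
      · exact absurd (h4 a ha) (hA haA hx (h4 a ha).ne)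
    · refine ⟨s, fun x hx => Or.inr ?_⟩
      obtain ⟨h1, m, h2, h3⟩ := h x hx
      exact (hD.parent_or_forall_adj hG h1 h2 h3).resolve_left (fun h4 => hp ⟨x, hx, h4⟩) s hs
  · refine ⟨v, fun x hx => Or.inl ?_⟩
    obtain ⟨h1, m, h2, h3⟩ := h x hx
    exact hD.eq_of_forall_not_parent (fun s hs => hv ⟨s, hs⟩)
      (by rcases h1 with h | h <;> omega) h2 h3

/-- A family of pairwise disjoint closed neighbourhoods obtained greedily along the order
`Precedes` has `γ^i(G)` members. -/
theorem indepDomNumber_eq_card (hD : IsLayering G D) (hG : IsDistanceHereditary G) (P : Finset V)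
    (hP : ∀ p ∈ P, ∀ q ∈ P, ∀ m, ClosedAdj G m p → ClosedAdj G m q → p = q)
    (hcov : ∀ x, ∃ p ∈ P, Precedes G D p x ∧ ∃ m, ClosedAdj G m p ∧ ClosedAdj G m x) :
    indepDomNumber G = P.card := by
  classical
  have hub : ∀ A : Set V, G.IsIndepSet A → domNumber G A ≤ P.card := by
    intro A hA
    -- Split `A` into classes, one for each picked vertex; the dominator `f p` takes care of the
    -- class of `p`.
    have : ∀ p, ∃ d, ∀ x ∈ {x ∈ A | Precedes G D p x ∧
        ∃ m, ClosedAdj G m p ∧ ClosedAdj G m x}, x = d ∨ G.Adj d x := fun p =>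
      hD.exists_dominator hG (hA.mono fun x hx => hx.1) p fun x hx => hx.2
    choose f hf using this
    refine le_trans (Nat.sInf_le ⟨P.image f, ?_, rfl⟩) Finset.card_image_le
    intro x hx
    obtain ⟨p, hp, h1⟩ := hcov x
    refine Set.mem_biUnion (x := f p) (by simpa using ⟨p, hp, rfl⟩) ?_
    simpa using hf p x ⟨hx, h1⟩
  have hind : G.IsIndepSet (P : Set V) := fun p hp q hq hne hadj =>
    hne (hP p hp q hq p (Or.inl rfl) (Or.inr hadj))
  have hlb : P.card ≤ domNumber G (P : Set V) := by
    refine le_csInf ⟨_, Finset.univ, fun x _ => ?_, rfl⟩ ?_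
    · exact Set.mem_biUnion (x := x) (by simp) (by simp)
    · rintro k ⟨Q, hQ, rfl⟩
      -- Disjointness of the closed neighbourhoods makes the choice of dominators injective.
      have : ∀ p ∈ P, ∃ d ∈ Q, ClosedAdj G d p := by
        intro p hp
        obtain ⟨d, hd, hpd⟩ := Set.mem_iUnion₂.1 (hQ hp)
        refine ⟨d, hd, ?_⟩
        rcases hpd with rfl | h
        · exact Or.inl rfl
        · exact Or.inr h
      choose! g hg hg' using this
      exact Finset.card_le_card_of_injOn g hg fun p hp q hq hpq =>
        hP p hp q hq _ (hg' p hp) (hpq ▸ hg' q hq)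
  refine le_antisymm (csSup_le' ?_) (hlb.trans (le_csSup ⟨P.card, ?_⟩ ⟨_, hind, rfl⟩)) <;>
  · rintro k ⟨A, hA, rfl⟩
    exact hub A hA

end IsLayering

end Graphs

/-! ### Reasoning about programs with step bounds. -/

@[simp] theorem State.setReg_reg (s : State) (x v y : ℕ) :
    (s.setReg x v).reg y = if y = x then v else s.reg y := by
  simp [State.setReg, Function.update_apply]

@[simp] theorem State.setReg_arr (s : State) (x v : ℕ) : (s.setReg x v).arr = s.arr := rfl

@[simp] theorem State.setCell_reg (s : State) (a i v : ℕ) : (s.setCell a i v).reg = s.reg := rfl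

@[simp] theorem State.setCell_arr (s : State) (a i v b k : ℕ) :
    (s.setCell a i v).arr b k = if b = a ∧ k = i then v else s.arr b k := by
  by_cases hb : b = a
  · subst hb
    simp [State.setCell, Function.update_apply]
  · simp [State.setCell, hb]

/-- Started in `s`, the program `p` halts within `T` steps in a state that satisfies `Q`. -/
def Halts (B T : ℕ) (p : Prog) (s : State) (Q : State → Prop) : Prop :=
  ∃ t s', t ≤ T ∧ Prog.Runs B p s t s' ∧ Q s'

namespace Halts

variable {B T T' : ℕ} {p q : Prog} {s : State} {Q R : State → Prop}

theorem mono (h : Halts B T p s Q) (hT : T ≤ T') : Halts B T' p s Q := by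
  obtain ⟨t, s', h1, h2⟩ := h
  exact ⟨t, s', h1.trans hT, h2⟩

theorem imp (h : Halts B T p s Q) (hQ : ∀ s, Q s → R s) : Halts B T p s R := by
  obtain ⟨t, s', h1, h2, h3⟩ := h
  exact ⟨t, s', h1, h2, hQ _ h3⟩

theorem assign {x : ℕ} {e : Expr} (he : e.Fits B s) (hQ : Q (s.setReg x (e.eval s))) :
    Halts B (e.cost + 1) (.assign x e) s Q :=
  ⟨_, _, le_rfl, .assign s x e he, hQ⟩

theorem write {a : ℕ} {i e : Expr} (hi : i.Fits B s) (he : e.Fits B s)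
    (hQ : Q (s.setCell a (i.eval s) (e.eval s))) :
    Halts B (i.cost + e.cost + 1) (.write a i e) s Q :=
  ⟨_, _, le_rfl, .write s a i e hi he, hQ⟩

theorem seq (hp : Halts B T p s R) (hq : ∀ s, R s → Halts B T' q s Q) :
    Halts B (T + T') (.seq p q) s Q := by
  obtain ⟨t, s', h1, h2, h3⟩ := hp
  obtain ⟨t', s'', h4, h5, h6⟩ := hq s' h3
  exact ⟨_, _, Nat.add_le_add h1 h4, .seq h2 h5, h6⟩

end Halts

/-- Do `p` if `e` is not `0`. -/
def Prog.whenever (e : Expr) (p : Prog) : Prog := .ite e p .skip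

/-- Do `p` with register `x` holding `0`, `1`, and so on up to `reg 0 - 1`. -/
def Prog.forLoop (x : ℕ) (p : Prog) : Prog :=
  .seq (.assign x (.const 0))
    (.loop (.lt (.reg x) (.reg 0)) (.seq p (.assign x (.add (.reg x) (.const 1)))))

namespace Halts

variable {B T T' : ℕ} {p q : Prog} {s : State} {Q R : State → Prop}

theorem whenever {e : Expr} (he : e.Fits B s) (h : e.eval s ≠ 0 → Halts B T p s Q)
    (h' : e.eval s = 0 → Q s) : Halts B (e.cost + 2 + T) (.whenever e p) s Q := by
  by_cases h0 : e.eval s = 0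
  · exact ⟨_, _, by omega, .ite_false p he h0 (.skip s), h' h0⟩
  · obtain ⟨t, s', h1, h2, h3⟩ := h h0
    exact ⟨_, _, by omega, .ite_true .skip he h0 h2, h3⟩

theorem forLoop {x n : ℕ} (hB : n < B) (I : ℕ → State → Prop) (h0 : I 0 s)
    (hn : ∀ i s, I i s → s.reg 0 = n)
    (hx : ∀ i s v, I i s → I i (s.setReg x v))
    (hbody : ∀ i s, i < n → I i s → s.reg x = i →
      Halts B T p s fun s' => I (i + 1) s' ∧ s'.reg x = i)
    (hQ : ∀ s, I n s → Q s) : Halts B ((T + 14) * (n + 1)) (.forLoop x p) s Q := by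
  -- Induction on the number `k` of rounds that remain.
  have key : ∀ k i s, i + k = n → I i s → s.reg x = i →
      Halts B (k * (T + 8) + 4) (.loop (.lt (.reg x) (.reg 0))
        (.seq p (.assign x (.add (.reg x) (.const 1))))) s Q := by
    intro k
    induction k with
    | zero =>
      intro i s hi hI hxi
      have h1 := hn i s hI
      obtain rfl : i = n := by omega
      exact ⟨_, s, by simp [Expr.cost], Prog.Runs.loop_stop _
        (by simp only [Expr.Fits]; omega) (by simp [Expr.eval, h1, hxi]), hQ s hI⟩
    | succ k ih =>
      intro i s hi hI hxi
      have h1 := hn i s hI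
      obtain ⟨t, s', h2, h3, h4, h5⟩ := hbody i s (by omega) hI hxi
      have h6 : (Expr.add (.reg x) (.const 1)).eval s' = i + 1 := by simp [Expr.eval, h5]
      obtain ⟨t', s'', h7, h8, h9⟩ := ih (i + 1)
        (s'.setReg x ((Expr.add (.reg x) (.const 1)).eval s')) (by omega) (hx _ _ _ h4)
        (by simp [h6])
      refine ⟨_, s'', ?_, .loop_step (by simp only [Expr.Fits]; omega)
        (by simp only [Expr.eval, h1, hxi]; split_ifs <;> omega)
        (.seq h3 (.assign _ _ _ (by simp only [Expr.Fits, Expr.eval]; omega))) h8, h9⟩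
      simp only [Expr.cost]
      have : (k + 1) * (T + 8) = k * (T + 8) + (T + 8) := by ring
      omega
  refine (seq (R := fun s => I 0 s ∧ s.reg x = 0) (assign ?_ ⟨hx _ _ _ h0, ?_⟩)
    fun s hs => key n 0 s (by omega) hs.1 hs.2).mono ?_
  · simp [Expr.Fits]
  · simp [Expr.eval]
  · simp only [Expr.cost]
    ring_nf
    omega

end Halts

/-! ### Matrix access and word bounds. -/

/-- The expression `u * n + w`, for registers `u` and `w`. -/
def Expr.index (u w : ℕ) : Expr := .add (.mul (.reg u) (.reg 0)) (.reg w)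

theorem mul_add_lt_mul_self {n a b : ℕ} (ha : a < n) (hb : b < n) : a * n + b < n * n := by
  have : (a + 1) * n ≤ n * n := Nat.mul_le_mul_right n ha
  linarith [Nat.succ_mul a n]

theorem mul_add_inj {n a b c d : ℕ} (hb : b < n) (hd : d < n) :
    a * n + b = c * n + d ↔ a = c ∧ b = d := by
  refine ⟨fun h => ?_, by rintro ⟨rfl, rfl⟩; rfl⟩
  have h1 : (a * n + b) / n = a := by
    rw [Nat.mul_comm, Nat.mul_add_div (by omega), Nat.div_eq_of_lt hb, Nat.add_zero]
  have h2 : (c * n + d) / n = c := by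
    rw [Nat.mul_comm, Nat.mul_add_div (by omega), Nat.div_eq_of_lt hd, Nat.add_zero]
  obtain rfl : a = c := by rw [← h1, h, h2]
  exact ⟨rfl, by omega⟩

theorem Expr.fits_index {B n u w : ℕ} {s : State} (hB : (n + 2) ^ 2 ≤ B) (h0 : s.reg 0 = n)
    (hu : s.reg u < n) (hw : s.reg w < n) : (Expr.index u w).Fits B s := by
  have h1 := mul_add_lt_mul_self hu hw
  have h2 : (n + 2) ^ 2 = n * n + 4 * n + 4 := by ring
  simp only [Expr.index, Expr.Fits, Expr.eval, h0]
  omega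

theorem Expr.eval_index {n u w : ℕ} {s : State} (h0 : s.reg 0 = n) :
    (Expr.index u w).eval s = s.reg u * n + s.reg w := by
  simp only [Expr.index, Expr.eval, h0]

/-- `e` evaluates to `0` or `1` without overflow. -/
def Expr.IsTest (B : ℕ) (s : State) (e : Expr) : Prop := e.Fits B s ∧ e.eval s ≤ 1

theorem Expr.IsTest.mul {B : ℕ} {s : State} {e f : Expr} (hB : 1 ≤ B) (he : e.IsTest B s)
    (hf : f.IsTest B s) : (Expr.mul e f).IsTest B s := by
  have : e.eval s * f.eval s ≤ 1 := Nat.mul_le_mul he.2 hf.2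
  exact ⟨⟨he.1, hf.1, this.trans hB⟩, this⟩

theorem Expr.isTest_eq {B : ℕ} {s : State} {e f : Expr} (hB : 1 ≤ B) (he : e.Fits B s)
    (hf : f.Fits B s) : (Expr.eq e f).IsTest B s :=
  ⟨⟨he, hf, hB⟩, by simp only [Expr.eval]; split_ifs <;> omega⟩

theorem Expr.isTest_lt {B : ℕ} {s : State} {e f : Expr} (hB : 1 ≤ B) (he : e.Fits B s)
    (hf : f.Fits B s) : (Expr.lt e f).IsTest B s :=
  ⟨⟨he, hf, hB⟩, by simp only [Expr.eval]; split_ifs <;> omega⟩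

variable {n : ℕ} {G : SimpleGraph (Fin n)}

open Classical in
/-- Register `0` holds `n` and array `0` the adjacency matrix with ones on the diagonal. -/
def HoldsMatrix (G : SimpleGraph (Fin n)) (s : State) : Prop :=
  s.reg 0 = n ∧ ∀ i j : Fin n, s.arr 0 ((i : ℕ) * n + j) = if ClosedAdj G i j then 1 else 0

theorem HoldsMatrix.setReg {s : State} (h : HoldsMatrix G s) {x : ℕ} (hx : x ≠ 0) (v : ℕ) :
    HoldsMatrix G (s.setReg x v) := by
  simpa [HoldsMatrix, hx.symm] using h

theorem HoldsMatrix.setCell {s : State} (h : HoldsMatrix G s) {a : ℕ} (ha : a ≠ 0) (i v : ℕ) :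
    HoldsMatrix G (s.setCell a i v) := by
  simpa [HoldsMatrix, ha.symm] using h

theorem HoldsMatrix.isTest {B u w : ℕ} {s : State} {a b : Fin n} (hB : (n + 2) ^ 2 ≤ B)
    (h : HoldsMatrix G s) (hu : s.reg u = a) (hw : s.reg w = b) :
    (Expr.cell 0 (.index u w)).IsTest B s := by
  have h1 : (Expr.cell 0 (.index u w)).eval s ≤ 1 := by
    simp only [Expr.eval, Expr.eval_index h.1, hu, hw, h.2]
    split_ifs <;> omega
  have : 1 ≤ (n + 2) ^ 2 := Nat.one_le_pow _ _ (by omega)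
  exact ⟨⟨Expr.fits_index hB h.1 (hu ▸ a.2) (hw ▸ b.2), h1.trans (this.trans hB)⟩, h1⟩

open Classical in
theorem HoldsMatrix.eval {u w : ℕ} {s : State} {a b : Fin n}
    (h : HoldsMatrix G s) (hu : s.reg u = a) (hw : s.reg w = b) :
    (Expr.cell 0 (.index u w)).eval s = if ClosedAdj G a b then 1 else 0 := by
  simp only [Expr.eval, Expr.eval_index h.1, hu, hw, h.2]

theorem add_two_le_of_sq_le {B : ℕ} (hB : (n + 2) ^ 2 ≤ B) : n + 2 ≤ B :=
  (Nat.le_self_pow (by norm_num) _).trans hB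

/-- Put ones on the diagonal of the adjacency matrix. -/
def Prog.closeMatrix : Prog := .forLoop 1 (.write 0 (.index 1 1) (.const 1))

theorem halts_closeMatrix {B : ℕ} (hB : (n + 2) ^ 2 ≤ B) :
    Halts B ((7 + 14) * (n + 1)) .closeMatrix (input G)
      fun s => HoldsMatrix G s ∧ ∀ k, s.arr 1 k = 0 := by
  classical
  have hB' := add_two_le_of_sq_le hB
  refine Halts.forLoop (n := n) (by omega) (fun i s => s.reg 0 = n ∧ (∀ a b : Fin n,
    s.arr 0 ((a : ℕ) * n + b) = (if (a = b ∧ (a : ℕ) < i) ∨ G.Adj a b then 1 else 0)) ∧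
    ∀ k, s.arr 1 k = 0) ⟨rfl, fun a b => ?_, fun k => by simp [input]⟩ (fun _ _ h => h.1) (fun i s v h => by simpa using h) ?_ ?_
  · simp only [input, Nat.not_lt_zero, and_false, false_or, true_and]
    congr 1
    apply propext
    constructor
    · rintro ⟨i, j, hij, h⟩
      obtain ⟨h1, h2⟩ := (mul_add_inj b.2 j.2).1 h
      rwa [Fin.ext h1, Fin.ext h2]
    · exact fun h => ⟨a, b, h, rfl⟩
  · rintro i s hi ⟨h0, h, h1⟩ hxi
    refine (Halts.write (Expr.fits_index hB h0 (by omega) (by omega))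
      (by simp only [Expr.Fits]; omega) ⟨⟨h0, fun a b => ?_, by simpa using h1⟩, hxi⟩).mono (by decide)
    simp only [State.setCell_arr, Expr.eval_index h0, hxi, mul_add_inj b.2 hi, true_and, h,
      Expr.eval, Fin.ext_iff]
    by_cases hab : (a : ℕ) = b ∧ (a : ℕ) = i
    · simp [hab.1.symm, hab.2]
    · have e1 : ¬ ((a : ℕ) = i ∧ (b : ℕ) = i) := by omega
      have e2 : ((a : ℕ) = b ∧ (a : ℕ) < i + 1) ↔ ((a : ℕ) = b ∧ (a : ℕ) < i) := by omega
      simp only [e1, e2, if_false]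
  · rintro s ⟨h0, h, h1⟩
    refine ⟨⟨h0, fun i j => ?_⟩, h1⟩
    rw [h]
    congr 1
    simp [ClosedAdj]

/-! ### Building the levels round by round. -/

/-- A partial layering with levels `1, …, t`, where `0` means that no level is assigned yet. -/
structure IsPartialLayering (G : SimpleGraph (Fin n)) (t : ℕ) (D : Fin n → ℕ) : Prop where
  le : ∀ v, D v ≤ t
  closed : ∀ u w, G.Adj u w → D u ≠ 0 → D u < t → D w ≠ 0 ∧ D w ≤ D u + 1
  parent_or_unique : ∀ x, D x ≠ 0 →
    (∃ u, G.Adj u x ∧ D u ≠ 0 ∧ D x = D u + 1) ∨ ∀ y, D y = D x → y = x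

/-- `D'` arises from `D` by giving level `t + 1` to vertices without level that have a
neighbour in level `t`; for the pairs that satisfy `R` this has been done. -/
structure Explores (G : SimpleGraph (Fin n)) (t : ℕ) (D : Fin n → ℕ) (R : Fin n → Fin n → Prop)
    (D' : Fin n → ℕ) : Prop where
  old : ∀ w, D w ≠ 0 → D' w = D w
  new : ∀ w, D w = 0 → D' w = 0 ∨ D' w = t + 1 ∧ t ≠ 0 ∧ ∃ u, G.Adj u w ∧ D u = t
  done : ∀ u w, R u w → G.Adj u w → D u = t → t ≠ 0 → D' w ≠ 0

/-- `D'` results from `D` in one round of the construction of the levels. -/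
structure Advances (G : SimpleGraph (Fin n)) (t : ℕ) (D D₁ D' : Fin n → ℕ) : Prop where
  explores : Explores G t D (fun _ _ => True) D₁
  cases : D' = D₁ ∧ ((∃ w, D₁ w = t + 1) ∨ ∀ w, D₁ w ≠ 0) ∨
    (∀ w, D₁ w ≠ t + 1) ∧ ∃ r, D₁ r = 0 ∧ D' = Function.update D₁ r (t + 1)

theorem IsPartialLayering.explores {t : ℕ} {D D' : Fin n → ℕ} (h : IsPartialLayering G t D)
    (h' : Explores G t D (fun _ _ => True) D') : IsPartialLayering G (t + 1) D' := by
  have key : ∀ w, D' w ≠ t + 1 → D w = D' w := by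
    intro w hw
    by_cases h0 : D w = 0
    · rcases h'.new w h0 with h1 | h1
      · rw [h0, h1]
      · exact absurd h1.1 hw
    · exact (h'.old w h0).symm
  have hle : ∀ w, D' w ≤ t + 1 := by
    intro w
    by_cases hw : D' w = t + 1
    · exact hw.le
    · rw [← key w hw]
      exact (h.le w).trans (Nat.le_succ t)
  refine ⟨hle, fun u w huw hu hut => ?_, fun x hx => ?_⟩
  · have h0 := key u (by omega)
    rw [← h0] at hu hut ⊢
    rcases Nat.lt_or_eq_of_le (Nat.le_of_lt_succ hut) with h1 | h1
    · have := h.closed u w huw hu h1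
      rwa [h'.old w this.1]
    · exact ⟨h'.done u w trivial huw h1 (by omega), h1 ▸ hle w⟩
  · by_cases hx' : D x = 0
    · obtain ⟨h1, h2, u, h3, h4⟩ := (h'.new x hx').resolve_left hx
      have h5 := h'.old u (by omega)
      exact Or.inl ⟨u, h3, by omega, by omega⟩
    · rw [h'.old x hx']
      refine (h.parent_or_unique x hx').imp ?_ ?_
      · rintro ⟨u, h1, h2, h3⟩
        have h4 := h'.old u h2
        exact ⟨u, h1, by omega, by omega⟩
      · intro hu y hy
        have := h.le x
        exact hu y (by rw [key y (by omega), hy])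

/-- A new root is placed only when level `t + 1` is empty, so it is alone there. It is not adjacent
to any vertex with a level, since exploration has already given levels to all neighbours of such
vertices. -/
theorem IsPartialLayering.advances {t : ℕ} {D D₁ D' : Fin n → ℕ} (h : IsPartialLayering G t D)
    (h' : Advances G t D D₁ D') : IsPartialLayering G (t + 1) D' := by
  have h1 := h.explores h'.explores
  rcases h'.cases with ⟨rfl, -⟩ | ⟨hno, r, hr, rfl⟩
  · exact h1
  have hle : ∀ v, Function.update D₁ r (t + 1) v ≤ t + 1 := fun v => by
    rw [Function.update_apply]
    split_ifs
    exacts [le_rfl, h1.le v]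
  refine ⟨hle, fun u w huw hu hut => ?_, fun x hx => ?_⟩
  · have hur : u ≠ r := by
      rintro rfl
      simp at hut
    rw [Function.update_of_ne hur] at hu hut ⊢
    have h2 := h1.closed u w huw hu hut
    have hwr : w ≠ r := by
      rintro rfl
      exact h2.1 hr
    rwa [Function.update_of_ne hwr]
  · by_cases hxr : x = r
    · subst hxr
      refine Or.inr fun y hy => ?_
      by_contra hne
      rw [Function.update_of_ne hne, Function.update_self] at hy
      exact hno y hy
    · rw [Function.update_of_ne hxr] at hx ⊢
      refine (h1.parent_or_unique x hx).imp ?_ ?_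
      · rintro ⟨u, h2, h3, h4⟩
        have hur : u ≠ r := by
          rintro rfl
          exact h3 hr
        exact ⟨u, h2, by rwa [Function.update_of_ne hur], by rwa [Function.update_of_ne hur]⟩
      · intro hu y hy
        have hyr : y ≠ r := by
          rintro rfl
          rw [Function.update_self] at hy
          exact hno x hy.symm
        rw [Function.update_of_ne hyr] at hy
        exact hu y hy

/-- This measures progress: as long as some vertex has no level, every round fills a further level.
-/
theorem Advances.full_or_levels {t : ℕ} {D D₁ D' : Fin n → ℕ} (h' : Advances G t D D₁ D')
    (h : (∀ v, D v ≠ 0) ∨ ∀ k, 1 ≤ k → k ≤ t → ∃ v, D v = k) :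
    (∀ v, D' v ≠ 0) ∨ ∀ k, 1 ≤ k → k ≤ t + 1 → ∃ v, D' v = k := by
  rcases h with h | h
  · left
    have hD : ∀ v, D₁ v ≠ 0 := fun v => by
      rw [h'.explores.old v (h v)]
      exact h v
    rcases h'.cases with ⟨rfl, -⟩ | ⟨-, r, hr, -⟩
    · exact hD
    · exact absurd hr (hD r)
  · rcases h'.cases with ⟨rfl, ⟨w, hw⟩ | hw⟩ | ⟨-, r, hr, rfl⟩
    · refine Or.inr fun k h1 h2 => ?_
      rcases Nat.lt_or_eq_of_le h2 with h3 | h3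
      · obtain ⟨v, hv⟩ := h k h1 (by omega)
        exact ⟨v, by rw [h'.explores.old v (by omega), hv]⟩
      · exact ⟨w, by omega⟩
    · exact Or.inl hw
    · refine Or.inr fun k h1 h2 => ?_
      rcases Nat.lt_or_eq_of_le h2 with h3 | h3
      · obtain ⟨v, hv⟩ := h k h1 (by omega)
        have h4 := h'.explores.old v (by omega)
        have hvr : v ≠ r := by
          rintro rfl
          omega
        exact ⟨v, by rw [Function.update_of_ne hvr, h4, hv]⟩
      · exact ⟨r, by simpa using h3.symm⟩

theorem IsPartialLayering.isLayering {D : Fin n → ℕ} (h : IsPartialLayering G n D)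
    (h' : (∀ v, D v ≠ 0) ∨ ∀ k, 1 ≤ k → k ≤ n → ∃ v, D v = k) :
    IsLayering G D ∧ ∀ v, 1 ≤ D v ∧ D v ≤ n := by
  have hpos : ∀ v, D v ≠ 0 := by
    by_contra! hcon
    obtain ⟨v, hv⟩ := hcon
    have hk := h'.resolve_left fun h => h v hv
    -- If a vertex still had value `0`, all `n + 1` values `0, …, n` would be taken by only `n`
    -- vertices.
    have hsub : Finset.range (n + 1) ⊆ Finset.univ.image D := by
      intro k hkn
      rw [Finset.mem_range] at hkn
      simp only [Finset.mem_image, Finset.mem_univ, true_and]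
      rcases Nat.eq_zero_or_pos k with h0 | hpos
      · exact ⟨v, hv.trans h0.symm⟩
      · exact hk k hpos (by omega)
    have := (Finset.card_le_card hsub).trans Finset.card_image_le
    simp at this
  refine ⟨⟨fun u w huw => ?_, fun x => ?_⟩, fun v => ⟨Nat.one_le_iff_ne_zero.2 (hpos v), h.le v⟩⟩
  · rcases Nat.lt_or_eq_of_le (h.le u) with h1 | h1
    · exact (h.closed u w huw (hpos u) h1).2
    · have := h.le w
      omega
  · refine (h.parent_or_unique x (hpos x)).imp_left ?_
    rintro ⟨u, h1, -, h2⟩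
    exact ⟨u, h1, h2⟩

/-! ### Programs for the levels. -/

/-- Array `1` holds `D`. -/
def HoldsLevels (D : Fin n → ℕ) (s : State) : Prop := ∀ v : Fin n, s.arr 1 v = D v

/-- Give level `reg 1 + 1` to the vertices without level that have a neighbour of
level `reg 1`; register `4` tells whether there are any. -/
def Prog.explore : Prog :=
  .seq (.assign 4 (.const 0)) <| .forLoop 2 <| .forLoop 3 <|
    .whenever (.mul (.cell 0 (.index 2 3)) (.mul (.eq (.cell 1 (.reg 2)) (.reg 1))
      (.mul (.eq (.cell 1 (.reg 3)) (.const 0)) (.lt (.const 0) (.reg 1)))))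
    (.seq (.write 1 (.reg 3) (.add (.reg 1) (.const 1))) (.assign 4 (.const 1)))

/-- Unless register `4` is set, give level `reg 1 + 1` to the first vertex without level. -/
def Prog.newRoot : Prog :=
  .forLoop 2 <| .whenever (.mul (.eq (.reg 4) (.const 0)) (.eq (.cell 1 (.reg 2)) (.const 0)))
    (.seq (.write 1 (.reg 2) (.add (.reg 1) (.const 1))) (.assign 4 (.const 1)))

/-- The state while `Prog.explore` runs. -/
structure Exploring (G : SimpleGraph (Fin n)) (t : ℕ) (D : Fin n → ℕ) (R : Fin n → Fin n → Prop)
    (s : State) : Prop where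
  matrix : HoldsMatrix G s
  reg_one : s.reg 1 = t
  explores : Explores G t D R fun v => s.arr 1 v
  flag : s.reg 4 ≠ 0 ↔ ∃ w : Fin n, s.arr 1 w = t + 1
  flag_le : s.reg 4 ≤ 1

theorem Exploring.setReg {t : ℕ} {D : Fin n → ℕ} {R : Fin n → Fin n → Prop} {s : State}
    (h : Exploring G t D R s) {x : ℕ} (hx : x ≠ 0 ∧ x ≠ 1 ∧ x ≠ 4) (v : ℕ) :
    Exploring G t D R (s.setReg x v) :=
  ⟨h.matrix.setReg hx.1 v, by simpa [hx.2.1.symm] using h.reg_one, h.explores,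
    by simpa [hx.2.2.symm] using h.flag, by simpa [hx.2.2.symm] using h.flag_le⟩

theorem Exploring.congr {t : ℕ} {D : Fin n → ℕ} {R R' : Fin n → Fin n → Prop} {s : State}
    (h : Exploring G t D R s) (hR : ∀ u w, R' u w → R u w) : Exploring G t D R' s :=
  ⟨h.matrix, h.reg_one, ⟨h.explores.old, h.explores.new,
    fun u w hr => h.explores.done u w (hR u w hr)⟩, h.flag, h.flag_le⟩

/-- Updating array `1` during the scan is harmless: new entries are `t + 1`, so the vertices found
at level `t` are exactly those of level `t` in `D`. The test `0 < t` is needed because in round `0`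
the value `0` would otherwise pass for a level. -/
theorem halts_explore {B t : ℕ} {D : Fin n → ℕ} {s : State} (hB : (n + 2) ^ 2 ≤ B) (ht : t < n)
    (hs : HoldsMatrix G s) (hst : s.reg 1 = t) (hsD : HoldsLevels D s) (hD : ∀ v, D v ≤ t) :
    Halts B (2 + ((30 + 14) * (n + 1) + 14) * (n + 1)) .explore s
      (Exploring G t D fun _ _ => True) := by
  have hB' := add_two_le_of_sq_le hB
  have hinit : Exploring G t D (fun u _ => (u : ℕ) < 0) (s.setReg 4 0) := by
    refine ⟨hs.setReg (by decide) _, by simpa using hst,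
      ⟨fun w _ => hsD w, fun w hw => Or.inl ((hsD w).trans hw), fun u w h => by omega⟩,
      ?_, by simp⟩
    simp only [State.setReg_reg, if_true, ne_eq, not_true, false_iff, State.setReg_arr]
    rintro ⟨w, hw⟩
    have := hsD w
    have := hD w
    omega
  refine Halts.seq (Halts.assign (e := .const 0) (by simp [Expr.Fits]) hinit) fun s h0 => ?_
  refine Halts.forLoop (n := n) (by omega) (fun i => Exploring G t D fun u _ => (u : ℕ) < i) h0
    (fun _ _ h => h.matrix.1) (fun i s v h => h.setReg (by decide) v) ?_
    fun s h => h.congr fun u _ _ => u.2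
  intro i s hi h hsi
  -- The pairs already treated form an initial segment of the lexicographic order.
  refine Halts.forLoop (n := n) (by omega) (fun j s => (Exploring G t D fun u w =>
      (u : ℕ) < i ∨ (u : ℕ) = i ∧ (w : ℕ) < j) s ∧ s.reg 2 = i)
    ⟨h.congr fun u w hu => by omega, hsi⟩ (fun _ _ h => h.1.matrix.1)
    (fun j s v h => ⟨h.1.setReg (by decide) v, by simpa using h.2⟩) ?_
    fun s h => ⟨h.1.congr fun u w hu => by omega, h.2⟩
  intro j s hj ⟨h, hsi⟩ hsj
  have hu : s.reg 2 = (⟨i, hi⟩ : Fin n) := hsi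
  have hw : s.reg 3 = (⟨j, hj⟩ : Fin n) := hsj
  have hle : ∀ v : Fin n, s.arr 1 v ≤ t + 1 := fun v => by
    by_cases h0 : D v = 0
    · rcases h.explores.new v h0 with h1 | h1 <;> omega
    · have := h.explores.old v h0
      have := hD v
      omega
  have e1 : s.arr 1 i ≤ t + 1 := hle ⟨i, hi⟩
  have e2 : s.arr 1 j ≤ t + 1 := hle ⟨j, hj⟩
  have e3 := h.reg_one
  have htest := (h.matrix.isTest hB hu hw).mul (by omega) <|
    (Expr.isTest_eq (e := .cell 1 (.reg 2)) (f := .reg 1) (by omega)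
      (by simp only [Expr.Fits, Expr.eval, hsi]; omega) (by simp only [Expr.Fits]; omega)).mul
      (by omega) <| (Expr.isTest_eq (e := .cell 1 (.reg 3)) (f := .const 0) (by omega)
      (by simp only [Expr.Fits, Expr.eval, hsj]; omega) (by simp only [Expr.Fits]; omega)).mul
      (by omega) <| Expr.isTest_lt (e := .const 0) (f := .reg 1) (by omega)
      (by simp only [Expr.Fits]; omega) (by simp only [Expr.Fits]; omega)
  have heval : (Expr.mul (.cell 0 (.index 2 3)) (.mul (.eq (.cell 1 (.reg 2)) (.reg 1))
      (.mul (.eq (.cell 1 (.reg 3)) (.const 0)) (.lt (.const 0) (.reg 1))))).eval s ≠ 0 ↔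
      ClosedAdj G ⟨i, hi⟩ ⟨j, hj⟩ ∧ s.arr 1 i = t ∧ s.arr 1 j = 0 ∧ 0 < t := by
    rw [Expr.eval, h.matrix.eval hu hw]
    simp only [Expr.eval, hsi, hsj, e3, mul_ne_zero_iff, ne_eq, ite_eq_right_iff, one_ne_zero,
      imp_false, not_not]
  refine (Halts.whenever (T := 8) htest.1 (fun hne => ?_) fun he => ?_).mono (by decide)
  · obtain ⟨hadj, hi', hj', ht0⟩ := heval.1 hne
    have hadj : G.Adj ⟨i, hi⟩ ⟨j, hj⟩ := hadj.resolve_left fun h => by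
      rw [Fin.mk.injEq] at h
      subst h
      omega
    have hDi : D ⟨i, hi⟩ = t := by
      by_cases h0 : D ⟨i, hi⟩ = 0
      · rcases h.explores.new _ h0 with h1 | h1 <;> simp only at h1 <;> omega
      · rw [← h.explores.old _ h0]
        exact hi'
    have hDj : D ⟨j, hj⟩ = 0 := by
      by_contra h0
      exact h0 ((h.explores.old _ h0).symm.trans hj')
    refine (Halts.seq (Halts.write (Q := fun s' => s' = s.setCell 1 j (t + 1))
      (by simp only [Expr.Fits]; omega) (by simp only [Expr.Fits, Expr.eval]; omega)
      (by simp [Expr.eval, hsj, e3])) fun s' hs' => Halts.assign (by simp only [Expr.Fits]; omega)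
      ⟨⟨?_, ?_⟩, ?_⟩).mono (by decide)
    · subst hs'
      have harr : ∀ v : Fin n, (s.setCell 1 j (t + 1)).arr 1 v =
          if v = ⟨j, hj⟩ then t + 1 else s.arr 1 v := fun v => by simp [Fin.ext_iff]
      refine ⟨(h.matrix.setCell (by decide) _ _).setReg (by decide) _, by simpa using e3,
        ⟨fun w hw => ?_, fun w hw => ?_, fun u w huw hadj' hu ht => ?_⟩, ?_, by simp [Expr.eval]⟩
      · simp only [State.setReg_arr, harr]
        rw [if_neg (fun h : w = ⟨j, hj⟩ => hw (h.symm ▸ hDj)), h.explores.old w hw]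
      · simp only [State.setReg_arr, harr]
        by_cases hwj : w = ⟨j, hj⟩
        · subst hwj
          exact Or.inr ⟨if_pos rfl, ht0.ne', _, hadj, hDi⟩
        · rw [if_neg hwj]
          exact h.explores.new w hw
      · simp only [State.setReg_arr, harr]
        by_cases hwj : w = ⟨j, hj⟩
        · simp [hwj]
        · rw [if_neg hwj]
          have hwj : (w : ℕ) ≠ j := fun h => hwj (Fin.ext h)
          have huw : (u : ℕ) < i ∨ (u : ℕ) = i ∧ (w : ℕ) < j + 1 := huw
          have hR : (u : ℕ) < i ∨ (u : ℕ) = i ∧ (w : ℕ) < j := by omega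
          exact h.explores.done u w hR hadj' hu ht
      · refine iff_of_true (by simp [Expr.eval]) ⟨⟨j, hj⟩, ?_⟩
        simp
    · simp [hs', hsi]
    · simp [hs', hsj]
  · have he' := fun h => heval.2 h he
    refine ⟨⟨⟨h.matrix, e3, ⟨h.explores.old, h.explores.new, fun u w huw hadj hut ht => ?_⟩,
      h.flag, h.flag_le⟩, hsi⟩, hsj⟩
    by_cases hR : (u : ℕ) < i ∨ (u : ℕ) = i ∧ (w : ℕ) < j
    · exact h.explores.done u w hR hadj hut ht
    · have huw : (u : ℕ) < i ∨ (u : ℕ) = i ∧ (w : ℕ) < j + 1 := huw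
      obtain ⟨rfl, rfl⟩ : (u : ℕ) = i ∧ (w : ℕ) = j := by omega
      intro hw0
      exact he' ⟨Or.inr hadj, (h.explores.old _ (by omega)).trans hut, hw0, by omega⟩

theorem halts_newRoot {B t : ℕ} {D D₁ : Fin n → ℕ} {s : State} (hB : (n + 2) ^ 2 ≤ B)
    (ht : t < n) (hs : Exploring G t D (fun _ _ => True) s) (hD : HoldsLevels D₁ s)
    (hle : ∀ v, D₁ v ≤ t + 1) :
    Halts B ((30 + 14) * (n + 1)) .newRoot s fun s => HoldsMatrix G s ∧ s.reg 1 = t ∧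
      ∃ D', HoldsLevels D' s ∧ Advances G t D D₁ D' := by
  have hB' := add_two_le_of_sq_le hB
  have hfun : (fun v : Fin n => s.arr 1 v) = D₁ := funext hD
  have hexp := hs.explores
  rw [hfun] at hexp
  have hflag := hs.flag
  simp only [hD _] at hflag
  -- Register `4` also records that a root has been placed, so at most one is. The invariant
  -- separates the states before and after that event.
  refine Halts.forLoop (n := n) (by omega) (fun j s => HoldsMatrix G s ∧ s.reg 1 = t ∧
      s.reg 4 ≤ 1 ∧ (HoldsLevels D₁ s ∧ (s.reg 4 ≠ 0 ↔ ∃ w, D₁ w = t + 1) ∧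
        (s.reg 4 = 0 → ∀ w : Fin n, (w : ℕ) < j → D₁ w ≠ 0) ∨
      s.reg 4 ≠ 0 ∧ (∀ w, D₁ w ≠ t + 1) ∧ ∃ r, D₁ r = 0 ∧
        HoldsLevels (Function.update D₁ r (t + 1)) s))
    ⟨hs.matrix, hs.reg_one, hs.flag_le, Or.inl ⟨hD, hflag, by simp⟩⟩ (fun _ _ h => h.1.1)
    (fun j s v h => ⟨h.1.setReg (by decide) v, h.2⟩) ?_ ?_
  · rintro j s hj ⟨hs, hst, hle4, h⟩ hsj
    have hcell : s.arr 1 j ≤ t + 1 := by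
      rcases h with ⟨h, -⟩ | ⟨-, -, r, -, h⟩
      · exact (h ⟨j, hj⟩).trans_le (hle _)
      · refine (h ⟨j, hj⟩).trans_le ?_
        rw [Function.update_apply]
        split_ifs
        exacts [le_rfl, hle _]
    have htest := (Expr.isTest_eq (B := B) (s := s) (e := .reg 4) (f := .const 0) (by omega)
      (by simp only [Expr.Fits]; omega) (by simp only [Expr.Fits]; omega)).mul (by omega) <|
      Expr.isTest_eq (e := .cell 1 (.reg 2)) (f := .const 0) (by omega)
      (by simp only [Expr.Fits, Expr.eval, hsj]; omega) (by simp only [Expr.Fits]; omega)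
    have heval : (Expr.mul (.eq (.reg 4) (.const 0)) (.eq (.cell 1 (.reg 2)) (.const 0))).eval s
        ≠ 0 ↔ s.reg 4 = 0 ∧ s.arr 1 j = 0 := by
      by_cases h4 : s.reg 4 = 0 <;> simp [Expr.eval, hsj, h4]
    refine (Halts.whenever (T := 8) htest.1 (fun hne => ?_) fun he => ?_).mono (by decide)
    · obtain ⟨h4, hj'⟩ := heval.1 hne
      obtain ⟨hD₁, hfl, -⟩ := h.resolve_right fun h => h.1 h4
      refine (Halts.seq (Halts.write (Q := fun s' => s' = s.setCell 1 j (t + 1))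
        (by simp only [Expr.Fits]; omega) (by simp only [Expr.Fits, Expr.eval]; omega)
        (by simp [Expr.eval, hsj, hst])) fun s' hs' => Halts.assign (by simp only [Expr.Fits]; omega)
        ⟨⟨?_, ?_, ?_, Or.inr ⟨?_, ?_, ⟨j, hj⟩, ?_, ?_⟩⟩, ?_⟩).mono (by decide) <;> subst hs'
      · exact (hs.setCell (by decide) _ _).setReg (by decide) _
      · simpa using hst
      · simp [Expr.eval]
      · simp [Expr.eval]
      · exact fun w hw => hfl.2 ⟨w, hw⟩ h4
      · exact (hD₁ ⟨j, hj⟩).symm.trans hj'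
      · intro v
        simp [Function.update_apply, Fin.ext_iff, hD₁ v]
      · simpa using hsj
    · have he' := fun h => heval.2 h he
      refine ⟨⟨hs, hst, hle4, h.imp_left fun h => ⟨h.1, h.2.1, fun h4 w hw => ?_⟩⟩, hsj⟩
      rcases Nat.lt_or_eq_of_le (Nat.le_of_lt_succ hw) with h5 | h5
      · exact h.2.2 h4 w h5
      · intro h0
        exact he' ⟨h4, by rw [← h5, h.1 w, h0]⟩
  · rintro s ⟨hs, hst, -, ⟨h1, h2, h3⟩ | ⟨h4, hno, r, hr, h⟩⟩
    · refine ⟨hs, hst, D₁, h1, hexp, Or.inl ⟨rfl, ?_⟩⟩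
      by_cases h4 : s.reg 4 = 0
      · exact Or.inr fun w => h3 h4 w w.2
      · exact Or.inl (h2.1 h4)
    · exact ⟨hs, hst, _, h, hexp, Or.inr ⟨hno, r, hr, rfl⟩⟩

/-- Compute the levels into array `1`. -/
def Prog.layer : Prog := .forLoop 1 (.seq .explore .newRoot)

theorem halts_layer {B : ℕ} {s : State} (hB : (n + 2) ^ 2 ≤ B) (hs : HoldsMatrix G s)
    (hs0 : HoldsLevels (fun _ : Fin n => 0) s) :
    Halts B ((2 + ((30 + 14) * (n + 1) + 14) * (n + 1) + (30 + 14) * (n + 1) + 14) * (n + 1))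
      .layer s fun s => HoldsMatrix G s ∧ ∃ D : Fin n → ℕ, HoldsLevels D s ∧ IsLayering G D ∧
        ∀ v, 1 ≤ D v ∧ D v ≤ n := by
  have hB' := add_two_le_of_sq_le hB
  refine Halts.forLoop (n := n) (by omega) (fun t s => HoldsMatrix G s ∧ ∃ D : Fin n → ℕ,
      HoldsLevels D s ∧ IsPartialLayering G t D ∧
        ((∀ v, D v ≠ 0) ∨ ∀ k, 1 ≤ k → k ≤ t → ∃ v, D v = k))
    ⟨hs, _, hs0, ⟨fun _ => le_rfl, fun _ _ _ h => absurd rfl h, fun _ h => absurd rfl h⟩,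
      Or.inr fun k h1 h2 => by omega⟩ (fun _ _ h => h.1.1)
    (fun t s v h => ⟨h.1.setReg (by decide) v, h.2⟩) ?_ ?_
  · rintro t s ht ⟨hs, D, hD, h1, h2⟩ hst
    refine Halts.seq (halts_explore hB ht hs hst hD h1.le) fun s hs => ?_
    have h3 := h1.explores hs.explores
    refine (halts_newRoot hB ht hs (fun _ => rfl) h3.le).imp fun s ⟨h4, h5, D', h6, h7⟩ => ?_
    exact ⟨⟨h4, D', h6, h1.advances h7, h7.full_or_levels h2⟩, h5⟩
  · rintro s ⟨hs, D, hD, h1, h2⟩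
    exact ⟨hs, D, hD, h1.isLayering h2⟩

theorem HoldsLevels.setCell {D : Fin n → ℕ} {s : State} (h : HoldsLevels D s) {a : ℕ}
    (ha : a ≠ 1) (i v : ℕ) : HoldsLevels D (s.setCell a i v) := by
  simpa [HoldsLevels, ha.symm] using h

/-! ### Sorting keys. -/

open Classical in
/-- A number that sorts the vertices by decreasing level first, and by the number of parents
then. -/
noncomputable def key (G : SimpleGraph (Fin n)) (D : Fin n → ℕ) (v : Fin n) : ℕ :=
  (n - D v) * (n + 1) + (Finset.univ.filter fun u => Parent G D u v).card

theorem key_lt (D : Fin n → ℕ) (v : Fin n) : key G D v < (n + 2) ^ 2 := by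
  classical
  have h1 : (n - D v) * (n + 1) ≤ n * (n + 1) := Nat.mul_le_mul_right _ (Nat.sub_le _ _)
  have h2 := (Finset.univ.filter fun u => Parent G D u v).card_le_univ
  rw [Fintype.card_fin] at h2
  have h3 : (n + 2) ^ 2 = n * (n + 1) + 3 * n + 4 := by ring
  unfold key
  omega

/-- The number of parents is at most `n`, hence below the factor `n + 1`, so comparing keys is
comparing lexicographically. -/
theorem precedes_of_key_le {D : Fin n → ℕ} (hD : ∀ v, D v ≤ n) {v x : Fin n}
    (h : key G D v ≤ key G D x) : Precedes G D v x := by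
  classical
  have h2 := (Finset.univ.filter fun u => Parent G D u x).card_le_univ
  rw [Fintype.card_fin] at h2
  unfold key at h
  rcases lt_trichotomy (D x) (D v) with hlt | heq | hgt
  · exact Or.inl hlt
  · rw [heq] at h
    exact Or.inr ⟨heq, by omega⟩
  · have h3 : (n - D x + 1) * (n + 1) ≤ (n - D v) * (n + 1) :=
      Nat.mul_le_mul_right _ (by have := hD x; omega)
    rw [Nat.succ_mul] at h3
    omega

/-- Compute the keys into array `2`, and erase array `3`. -/
def Prog.keys : Prog :=
  .forLoop 1 <| .seq (.write 3 (.reg 1) (.const 0)) <|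
    .seq (.write 2 (.reg 1) (.mul (.sub (.reg 0) (.cell 1 (.reg 1))) (.add (.reg 0) (.const 1)))) <|
    .forLoop 2 <| .write 2 (.reg 1) (.add (.cell 2 (.reg 1)) (.mul (.cell 0 (.index 2 1))
      (.eq (.cell 1 (.reg 1)) (.add (.cell 1 (.reg 2)) (.const 1)))))

theorem halts_keys {B : ℕ} {D : Fin n → ℕ} {s : State} (hB : (n + 2) ^ 2 ≤ B)
    (hD : ∀ v, D v ≤ n) (hs : HoldsMatrix G s) (hsD : HoldsLevels D s) :
    Halts B ((20 + (20 + 14) * (n + 1) + 14) * (n + 1)) .keys s fun s =>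
      HoldsMatrix G s ∧ ∀ v : Fin n, s.arr 2 v = key G D v ∧ s.arr 3 v = 0 := by
  classical
  have hB' := add_two_le_of_sq_le hB
  refine Halts.forLoop (n := n) (by omega) (fun i s => HoldsMatrix G s ∧ HoldsLevels D s ∧
      ∀ v : Fin n, (v : ℕ) < i → s.arr 2 v = key G D v ∧ s.arr 3 v = 0)
    ⟨hs, hsD, fun v hv => by omega⟩ (fun _ _ h => h.1.1)
    (fun i s v h => ⟨h.1.setReg (by decide) v, h.2⟩) ?_ fun s h => ⟨h.1, fun v => h.2.2 v v.2⟩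
  rintro i s hi ⟨hs, hsD, h⟩ hsi
  have hDi : s.arr 1 i = D ⟨i, hi⟩ := hsD ⟨i, hi⟩
  have hDi' := hD ⟨i, hi⟩
  have hsq : (n + 2) ^ 2 = n * (n + 1) + 3 * n + 4 := by ring
  have hmul : (n - D ⟨i, hi⟩) * (n + 1) ≤ n * (n + 1) := Nat.mul_le_mul_right _ (Nat.sub_le _ _)
  have h0 := hs.1
  refine (Halts.seq (Halts.write (Q := fun s' => s' = s.setCell 3 i 0)
    (by simp only [Expr.Fits]; omega) (by simp only [Expr.Fits]; omega) (by simp [Expr.eval, hsi]))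
    fun s' hs' => Halts.seq (Halts.write
      (Q := fun s'' => s'' = s'.setCell 2 i ((n - D ⟨i, hi⟩) * (n + 1)))
    (by subst hs'; simp only [Expr.Fits, State.setCell_reg]; omega) ?_
    (by subst hs'; simp [Expr.eval, hsi, h0, hDi])) fun s'' hs'' =>
    -- The second cell summand counts the parents of vertex `i` among the first `j` vertices.
    Halts.forLoop (T := 20) (x := 2) (n := n) (by omega) (fun j s => HoldsMatrix G s ∧ HoldsLevels D s ∧
      (∀ v : Fin n, (v : ℕ) < i → s.arr 2 v = key G D v ∧ s.arr 3 v = 0) ∧ s.reg 1 = i ∧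
      s.arr 3 i = 0 ∧ s.arr 2 i = (n - D ⟨i, hi⟩) * (n + 1) +
        (Finset.univ.filter fun u : Fin n => (u : ℕ) < j ∧ Parent G D u ⟨i, hi⟩).card)
      ?_ (fun _ _ h => h.1.1) (fun i s v h => ⟨h.1.setReg (by decide) v, h.2⟩) ?_ ?_).mono
        (by simp only [Expr.cost]; omega)
  · subst hs'
    simp [Expr.Fits, Expr.eval, hsi, h0, hDi]
    omega
  · subst hs'' hs'
    refine ⟨(hs.setCell (by decide) _ _).setCell (by decide) _ _,
      (hsD.setCell (by decide) _ _).setCell (by decide) _ _, fun v hv => ?_, by simpa using hsi,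
      by simp, by simp⟩
    have hvi : (v : ℕ) ≠ i := hv.ne
    simpa [hvi] using h v hv
  · rintro j s hj ⟨hs, hsD, h, hsi, h3, h2⟩ hsj
    have hDi : s.arr 1 i = D ⟨i, hi⟩ := hsD ⟨i, hi⟩
    have hDj : s.arr 1 j = D ⟨j, hj⟩ := hsD ⟨j, hj⟩
    have hDj' := hD ⟨j, hj⟩
    have hu : s.reg 2 = (⟨j, hj⟩ : Fin n) := hsj
    have hv : s.reg 1 = (⟨i, hi⟩ : Fin n) := hsi
    have hcard := (Finset.univ.filter fun u : Fin n =>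
      (u : ℕ) < j ∧ Parent G D u ⟨i, hi⟩).card_le_univ
    rw [Fintype.card_fin] at hcard
    have htest := (hs.isTest hB hu hv).mul (by omega) <|
      Expr.isTest_eq (e := .cell 1 (.reg 1)) (f := .add (.cell 1 (.reg 2)) (.const 1)) (by omega)
      (by simp only [Expr.Fits, Expr.eval, hsi]; omega)
      (by simp only [Expr.Fits, Expr.eval, hsj]; omega)
    have heval : (Expr.mul (.cell 0 (.index 2 1)) (.eq (.cell 1 (.reg 1))
        (.add (.cell 1 (.reg 2)) (.const 1)))).eval s =
        if Parent G D ⟨j, hj⟩ ⟨i, hi⟩ then 1 else 0 := by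
      rw [Expr.eval, hs.eval hu hv]
      simp only [Expr.eval, hsi, hsj, hDi, hDj, Parent, ClosedAdj, Fin.mk.injEq, mul_ite, mul_one,
        mul_zero, ← ite_and]
      congr 1
      apply propext
      constructor
      · rintro ⟨h1, rfl | h2⟩
        · omega
        · exact ⟨h2, h1⟩
      · exact fun h => ⟨h.2, Or.inr h.1⟩
    have hle := htest.2
    have hcell : (Expr.cell 2 (.reg 1)).eval s = s.arr 2 i := by simp [Expr.eval, hsi]
    have hfits : (Expr.add (.cell 2 (.reg 1)) (.mul (.cell 0 (.index 2 1)) (.eq (.cell 1 (.reg 1))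
        (.add (.cell 1 (.reg 2)) (.const 1))))).Fits B s :=
      ⟨by simp only [Expr.Fits, Expr.eval, hsi]; omega, htest.1, by omega⟩
    refine (Halts.write (by simp only [Expr.Fits]; omega) hfits
      ⟨⟨hs.setCell (by decide) _ _, hsD.setCell (by decide) _ _, fun v hv => ?_, hsi, ?_, ?_⟩,
        hsj⟩).mono (by decide)
    · have hvi : (v : ℕ) ≠ i := hv.ne
      simpa [Expr.eval, hsi, hvi] using h v hv
    · simpa using h3
    · have hins : (if Parent G D ⟨j, hj⟩ ⟨i, hi⟩ then 1 else 0) +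
          (Finset.univ.filter fun u : Fin n => (u : ℕ) < j ∧ Parent G D u ⟨i, hi⟩).card =
          (Finset.univ.filter fun u : Fin n =>
            (u : ℕ) < j + 1 ∧ Parent G D u ⟨i, hi⟩).card := by
        have hlt : ∀ u : Fin n, (u : ℕ) < j + 1 ↔ u = ⟨j, hj⟩ ∨ (u : ℕ) < j := fun u => by
          rw [Fin.ext_iff]
          simp only
          omega
        simp only [hlt, or_and_right]
        rw [Finset.filter_or, Finset.card_union_of_disjoint]
        · congr 1
          split_ifs with hp
          · rw [eq_comm, Finset.card_eq_one]
            refine ⟨⟨j, hj⟩, ?_⟩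
            ext u
            simp only [Finset.mem_filter_univ, Finset.mem_singleton]
            exact ⟨fun h => h.1, by rintro rfl; exact ⟨rfl, hp⟩⟩
          · rw [eq_comm, Finset.card_eq_zero, Finset.filter_eq_empty_iff]
            rintro u - ⟨rfl, h⟩
            exact hp h
        · rw [Finset.disjoint_filter]
          rintro u - ⟨rfl, -⟩ ⟨h, -⟩
          simp only [lt_self_iff_false] at h
      rw [← hins]
      have : (Expr.reg 1).eval s = i := hsi
      rw [State.setCell_arr, if_pos ⟨rfl, this.symm⟩, Expr.eval, heval]
      simp only [Expr.eval, hsi, h2]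
      ring
  · rintro s ⟨hs, hsD, h, hsi, h3, h2⟩
    refine ⟨⟨hs, hsD, fun v hv => ?_⟩, hsi⟩
    rcases Nat.lt_or_eq_of_le (Nat.le_of_lt_succ hv) with hv | rfl
    · exact h v hv
    · refine ⟨h2.trans ?_, h3⟩
      simp [key]

/-! ### Greedy selection. -/

/-- The closed neighbourhoods of `p` and `x` meet. -/
def Meets (G : SimpleGraph (Fin n)) (p x : Fin n) : Prop := ∃ m, ClosedAdj G m p ∧ ClosedAdj G m x

/-- The state of the greedy selection: array `2` holds the keys `K`, array `3` the vertices
blocked, register `1` the number of the round, register `6` the number of vertices picked. -/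
structure Selecting (G : SimpleGraph (Fin n)) (K : Fin n → ℕ) (blocked : Fin n → Prop)
    (i c : ℕ) (s : State) : Prop where
  matrix : HoldsMatrix G s
  keys : ∀ v : Fin n, s.arr 2 v = K v
  le_one : ∀ v : Fin n, s.arr 3 v ≤ 1
  ne_zero : ∀ v : Fin n, s.arr 3 v ≠ 0 ↔ blocked v
  round : s.reg 1 = i
  count : s.reg 6 = c

theorem Selecting.setReg {K : Fin n → ℕ} {b : Fin n → Prop} {i c : ℕ} {s : State}
    (h : Selecting G K b i c s) {x : ℕ} (hx : x ≠ 0 ∧ x ≠ 1 ∧ x ≠ 6) (v : ℕ) :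
    Selecting G K b i c (s.setReg x v) :=
  ⟨h.matrix.setReg hx.1 v, h.keys, h.le_one, h.ne_zero, by simpa [hx.2.1.symm] using h.round,
    by simpa [hx.2.2.symm] using h.count⟩

theorem Selecting.congr {K : Fin n → ℕ} {b b' : Fin n → Prop} {i c : ℕ} {s : State}
    (h : Selecting G K b i c s) (hb : ∀ v, b v ↔ b' v) : Selecting G K b' i c s :=
  ⟨h.matrix, h.keys, h.le_one, fun v => (h.ne_zero v).trans (hb v), h.round, h.count⟩

/-- A number larger than all keys. -/
def Expr.keyBound : Expr := .mul (.add (.reg 0) (.const 2)) (.add (.reg 0) (.const 2))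

theorem Expr.keyBound_eval {s : State} (h : s.reg 0 = n) : Expr.keyBound.eval s = (n + 2) ^ 2 := by
  simp only [keyBound, eval, h]
  ring

theorem Expr.keyBound_fits {B : ℕ} {s : State} (hB : (n + 2) ^ 2 ≤ B) (h : s.reg 0 = n) :
    Expr.keyBound.Fits B s := by
  have hB' := add_two_le_of_sq_le hB
  have := Expr.keyBound_eval h
  simp only [keyBound, eval] at this
  simp only [keyBound, Fits, eval]
  omega

/-- Put a vertex with least key among those not blocked into register `5`, and its key into
register `4`. -/
def Prog.select : Prog :=
  .seq (.assign 4 .keyBound) <| .forLoop 2 <|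
    .whenever (.mul (.eq (.cell 3 (.reg 2)) (.const 0)) (.lt (.cell 2 (.reg 2)) (.reg 4)))
      (.seq (.assign 4 (.cell 2 (.reg 2))) (.assign 5 (.reg 2)))

/-- Block all vertices whose closed neighbourhood meets that of the vertex in register `5`. -/
def Prog.block : Prog :=
  .forLoop 2 <| .forLoop 3 <| .whenever (.mul (.cell 0 (.index 3 5)) (.cell 0 (.index 3 2)))
    (.write 3 (.reg 2) (.const 1))

/-- Greedily pick vertices with disjoint closed neighbourhoods, and count them in
register `6`. -/
def Prog.greedy : Prog :=
  .seq (.assign 6 (.const 0)) <| .forLoop 1 <| .seq .select <|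
    .whenever (.lt (.reg 4) .keyBound) (.seq (.assign 6 (.add (.reg 6) (.const 1))) .block)

/-- The start value `(n + 2) ^ 2` exceeds every key, so it remains in register `4` exactly when all
vertices are blocked. -/
theorem halts_select {B i c : ℕ} {K : Fin n → ℕ} {b : Fin n → Prop} {s : State}
    (hB : (n + 2) ^ 2 ≤ B) (hK : ∀ v, K v < (n + 2) ^ 2) (hs : Selecting G K b i c s) :
    Halts B (8 + (20 + 14) * (n + 1)) .select s fun s => Selecting G K b i c s ∧
      (s.reg 4 = (n + 2) ^ 2 ∧ (∀ v, b v) ∨ ∃ p : Fin n, s.reg 5 = p ∧ s.reg 4 = K p ∧ ¬ b p ∧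
        ∀ v, ¬ b v → K p ≤ K v) := by
  have hB' := add_two_le_of_sq_le hB
  refine Halts.seq (Halts.assign (Q := fun s' => s' = s.setReg 4 ((n + 2) ^ 2))
    (Expr.keyBound_fits hB hs.matrix.1) (by rw [Expr.keyBound_eval hs.matrix.1])) fun s' hs' =>
    Halts.forLoop (T := 20) (x := 2) (n := n) (by omega) (fun j s => Selecting G K b i c s ∧
      (s.reg 4 = (n + 2) ^ 2 ∧ (∀ v : Fin n, (v : ℕ) < j → b v) ∨
        ∃ p : Fin n, s.reg 5 = p ∧ s.reg 4 = K p ∧ ¬ b p ∧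
        ∀ v : Fin n, (v : ℕ) < j → ¬ b v → K p ≤ K v))
      ?_ (fun _ _ h => h.1.matrix.1) (fun j s v h => ⟨h.1.setReg (by decide) v, h.2⟩) ?_ ?_
  · subst hs'
    exact ⟨hs.setReg (by decide) _, Or.inl ⟨by simp, fun v hv => by omega⟩⟩
  · rintro j s hj ⟨hs, h⟩ hsj
    have h3 : s.arr 3 j ≤ 1 := hs.le_one ⟨j, hj⟩
    have h3' : s.arr 3 j ≠ 0 ↔ b ⟨j, hj⟩ := hs.ne_zero ⟨j, hj⟩
    have h2 : s.arr 2 j = K ⟨j, hj⟩ := hs.keys ⟨j, hj⟩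
    have hKj := hK ⟨j, hj⟩
    have h4 : s.reg 4 ≤ (n + 2) ^ 2 := by
      rcases h with ⟨h, -⟩ | ⟨p, -, h, -⟩
      · exact h.le
      · exact h.trans_le (hK p).le
    have htest := (Expr.isTest_eq (B := B) (s := s) (e := .cell 3 (.reg 2)) (f := .const 0)
      (by omega) (by simp only [Expr.Fits, Expr.eval, hsj]; omega)
      (by simp only [Expr.Fits]; omega)).mul (by omega) <|
      Expr.isTest_lt (e := .cell 2 (.reg 2)) (f := .reg 4) (by omega)
      (by simp only [Expr.Fits, Expr.eval, hsj]; omega) (by simp only [Expr.Fits]; omega)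
    have heval : (Expr.mul (.eq (.cell 3 (.reg 2)) (.const 0))
        (.lt (.cell 2 (.reg 2)) (.reg 4))).eval s ≠ 0 ↔ ¬ b ⟨j, hj⟩ ∧ K ⟨j, hj⟩ < s.reg 4 := by
      rw [← h3', not_not]
      simp only [Expr.eval, hsj, h2, mul_ne_zero_iff, ne_eq, ite_eq_right_iff, one_ne_zero,
        imp_false, not_not]
    have hlt : ∀ v : Fin n, (v : ℕ) < j + 1 → v = ⟨j, hj⟩ ∨ (v : ℕ) < j := fun v hv => by
      rw [Fin.ext_iff]
      simp only
      omega
    refine (Halts.whenever (T := 5) htest.1 (fun hne => ?_) fun he => ?_).mono (by decide)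
    · obtain ⟨hbj, hlt4⟩ := heval.1 hne
      refine Halts.seq (Halts.assign (Q := fun s' => s' = s.setReg 4 (K ⟨j, hj⟩))
        (e := .cell 2 (.reg 2)) (by simp only [Expr.Fits, Expr.eval, hsj]; omega) (by simp [Expr.eval, hsj, h2]))
        fun s' hs' => Halts.assign (e := .reg 2) ?_ ⟨⟨?_, Or.inr ⟨⟨j, hj⟩, ?_, ?_, hbj, ?_⟩⟩, ?_⟩ <;>
        subst hs'
      · simp [Expr.Fits, hsj]
        omega
      · exact (hs.setReg (by decide) _).setReg (by decide) _
      · simp [Expr.eval, hsj]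
      · simp
      · intro v hv hbv
        rcases hlt v hv with rfl | hv
        · exact le_rfl
        · rcases h with ⟨-, h⟩ | ⟨p, -, hp, -, h⟩
          · exact absurd (h v hv) hbv
          · exact (hp ▸ hlt4).le.trans (h v hv hbv)
      · simpa using hsj
    · have he' := fun h => heval.2 h he
      refine ⟨⟨hs, h.imp ?_ ?_⟩, hsj⟩
      · rintro ⟨h5, h6⟩
        refine ⟨h5, fun v hv => ?_⟩
        rcases hlt v hv with rfl | hv
        · by_contra hbv
          exact he' ⟨hbv, h5 ▸ hKj⟩
        · exact h6 v hv
      · rintro ⟨p, h5, h6, h7, h8⟩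
        refine ⟨p, h5, h6, h7, fun v hv hbv => ?_⟩
        rcases hlt v hv with rfl | hv
        · by_contra hcon
          exact he' ⟨hbv, h6 ▸ not_le.1 hcon⟩
        · exact h8 v hv hbv
  · rintro s ⟨hs, h⟩
    refine ⟨hs, h.imp (fun h => ⟨h.1, fun v => h.2 v v.2⟩) ?_⟩
    rintro ⟨p, h1, h2, h3, h4⟩
    exact ⟨p, h1, h2, h3, fun v => h4 v v.2⟩

theorem halts_block {B i c : ℕ} {K : Fin n → ℕ} {b : Fin n → Prop} {s : State} {p : Fin n}
    (hB : (n + 2) ^ 2 ≤ B) (hs : Selecting G K b i c s) (hp : s.reg 5 = p) :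
    Halts B (((20 + 14) * (n + 1) + 14) * (n + 1)) .block s
      (Selecting G K (fun w => b w ∨ Meets G p w) i c) := by
  have hB' := add_two_le_of_sq_le hB
  refine Halts.forLoop (n := n) (by omega) (fun j s =>
      Selecting G K (fun w => b w ∨ (w : ℕ) < j ∧ Meets G p w) i c s ∧ s.reg 5 = p)
    ⟨hs.congr fun v => by simp, hp⟩ (fun _ _ h => h.1.matrix.1)
    (fun j s v h => ⟨h.1.setReg (by decide) v, h.2⟩) ?_ fun s h => h.1.congr fun v => by simp
  rintro j s hj ⟨hs, hp⟩ hsj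
  -- For the current vertex `j`, only the first `k` candidates for a common point of the two closed
  -- neighbourhoods have been tried.
  refine Halts.forLoop (n := n) (by omega) (fun k s => Selecting G K (fun w =>
      b w ∨ (w : ℕ) < j ∧ Meets G p w ∨ w = ⟨j, hj⟩ ∧
        ∃ m : Fin n, (m : ℕ) < k ∧ ClosedAdj G m p ∧ ClosedAdj G m w) i c s ∧
      s.reg 5 = p ∧ s.reg 2 = j)
    ⟨hs.congr fun v => by simp, hp, hsj⟩ (fun _ _ h => h.1.matrix.1)
    (fun j s v h => ⟨h.1.setReg (by decide) v, h.2⟩) ?_ ?_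
  · rintro k s hk ⟨hs, hp, hsj⟩ hsk
    have hm : s.reg 3 = (⟨k, hk⟩ : Fin n) := hsk
    have hw : s.reg 2 = (⟨j, hj⟩ : Fin n) := hsj
    have htest := (hs.matrix.isTest hB hm hp).mul (by omega) (hs.matrix.isTest hB hm hw)
    have heval : (Expr.mul (.cell 0 (.index 3 5)) (.cell 0 (.index 3 2))).eval s ≠ 0 ↔
        ClosedAdj G ⟨k, hk⟩ p ∧ ClosedAdj G ⟨k, hk⟩ ⟨j, hj⟩ := by
      rw [Expr.eval, hs.matrix.eval hm hp, hs.matrix.eval hm hw]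
      simp only [mul_ne_zero_iff, ne_eq, ite_eq_right_iff, one_ne_zero, imp_false, not_not]
    have hlt : ∀ v : Fin n, (v : ℕ) < k + 1 ↔ v = ⟨k, hk⟩ ∨ (v : ℕ) < k := fun v => by
      rw [Fin.ext_iff]
      simp only
      omega
    refine (Halts.whenever (T := 3) htest.1 (fun hne => ?_) fun he => ?_).mono (by decide)
    · have hadj := heval.1 hne
      refine Halts.write (i := .reg 2) (e := .const 1) (by simp only [Expr.Fits]; omega)
        (by simp only [Expr.Fits]; omega) ⟨⟨⟨hs.matrix.setCell (by decide) _ _, fun v => ?_,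
          fun v => ?_, fun v => ?_, hs.round, hs.count⟩, hp, hsj⟩, hsk⟩
      · simpa using hs.keys v
      · have := hs.le_one v
        simp only [State.setCell_arr, Expr.eval]
        split_ifs <;> omega
      · simp only [State.setCell_arr, Expr.eval, hsj, true_and]
        by_cases hv : (v : ℕ) = j
        · obtain rfl : v = ⟨j, hj⟩ := Fin.ext hv
          rw [if_pos rfl]
          exact iff_of_true one_ne_zero (Or.inr (Or.inr ⟨rfl, _, Nat.lt_succ_self k, hadj⟩))
        · rw [if_neg hv, hs.ne_zero v]
          have : v ≠ ⟨j, hj⟩ := fun h => hv (Fin.ext_iff.1 h)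
          simp only [this, false_and]
    · have he' := fun h => heval.2 h he
      refine ⟨⟨hs.congr fun v => or_congr_right (or_congr_right
        (and_congr_right fun hv => ?_)), hp, hsj⟩, hsk⟩
      subst hv
      constructor
      · rintro ⟨m, h1, h2⟩
        exact ⟨m, by omega, h2⟩
      · rintro ⟨m, h1, h2⟩
        rcases (hlt m).1 h1 with rfl | h1
        · exact absurd h2 he'
        · exact ⟨m, h1, h2⟩
  · rintro s ⟨hs, hp, hsj⟩
    refine ⟨⟨hs.congr fun v => or_congr_right ?_, hp⟩, hsj⟩
    have hlt : (v : ℕ) < j + 1 ↔ (v : ℕ) < j ∨ v = ⟨j, hj⟩ := by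
      rw [Fin.ext_iff]
      simp only
      omega
    rw [hlt, or_and_right]
    refine or_congr_right (and_congr_right fun _ => ?_)
    exact ⟨fun ⟨m, _, h⟩ => ⟨m, h⟩, fun ⟨m, h⟩ => ⟨m, m.2, h⟩⟩

/-- `P` arises by repeatedly picking a vertex with least key whose closed neighbourhood does not
meet those of the vertices picked before. -/
structure IsGreedy (G : SimpleGraph (Fin n)) (K : Fin n → ℕ) (P : Finset (Fin n)) : Prop where
  disjoint : ∀ p ∈ P, ∀ q ∈ P, Meets G p q → p = q
  le : ∀ x, (∃ p ∈ P, Meets G p x) → ∃ p ∈ P, K p ≤ K x ∧ Meets G p x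

/-- A vertex met by `p` but by no earlier pick was itself still available when `p` was chosen, so
its key is at least that of `p`. -/
theorem IsGreedy.insert [DecidableEq (Fin n)] {K : Fin n → ℕ} {P : Finset (Fin n)}
    (h : IsGreedy G K P) {p : Fin n} (hp : ¬ ∃ q ∈ P, Meets G q p)
    (hmin : ∀ v, (¬ ∃ q ∈ P, Meets G q v) → K p ≤ K v) : IsGreedy G K (insert p P) := by
  have hsymm : ∀ {a b}, Meets G a b → Meets G b a := fun ⟨m, h1, h2⟩ => ⟨m, h2, h1⟩
  refine ⟨fun a ha b hb hab => ?_, ?_⟩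
  · rw [Finset.mem_insert] at ha hb
    rcases ha with rfl | ha <;> rcases hb with rfl | hb
    · rfl
    · exact absurd ⟨b, hb, hsymm hab⟩ hp
    · exact absurd ⟨a, ha, hab⟩ hp
    · exact h.disjoint a ha b hb hab
  · rintro x ⟨a, ha, hax⟩
    by_cases hx : ∃ q ∈ P, Meets G q x
    · obtain ⟨q, hq, h1⟩ := h.le x hx
      exact ⟨q, Finset.mem_insert_of_mem hq, h1⟩
    · rcases Finset.mem_insert.1 ha with rfl | ha
      · exact ⟨a, Finset.mem_insert_self a P, hmin x hx, hax⟩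
      · exact absurd ⟨a, ha, hax⟩ hx

theorem halts_greedy {B : ℕ} {K : Fin n → ℕ} {s : State}
    (hB : (n + 2) ^ 2 ≤ B) (hK : ∀ v, K v < (n + 2) ^ 2) (hs : HoldsMatrix G s)
    (hs2 : ∀ v : Fin n, s.arr 2 v = K v ∧ s.arr 3 v = 0) :
    Halts B (2 + (8 + (20 + 14) * (n + 1) +
        (11 + (4 + ((20 + 14) * (n + 1) + 14) * (n + 1))) + 14) * (n + 1)) .greedy s
      fun s => ∃ P : Finset (Fin n), s.reg 6 = P.card ∧ IsGreedy G K P ∧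
        ∀ x, ∃ p ∈ P, Meets G p x := by
  classical
  have hB' := add_two_le_of_sq_le hB
  have hinit : Selecting G K (fun _ => False) (s.reg 1) 0 (s.setReg 6 0) :=
    ⟨hs.setReg (by decide) _, fun v => (hs2 v).1, fun v => (hs2 v).2.trans_le zero_le_one,
      fun v => by simp [(hs2 v).2], by simp, by simp⟩
  refine Halts.seq (Halts.assign (e := .const 0) (by simp [Expr.Fits]) hinit) fun s h0 =>
    Halts.forLoop (n := n) (by omega) (fun i s => ∃ P : Finset (Fin n), IsGreedy G K P ∧
      -- The round number is existentially quantified because the invariant has to survive arbitrary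
      -- changes of register `1`.
      (∃ k, Selecting G K (fun x => ∃ p ∈ P, Meets G p x) k P.card s) ∧
      (i ≤ P.card ∨ ∀ x, ∃ p ∈ P, Meets G p x))
    ⟨∅, ⟨by simp, by simp⟩, ⟨_, h0.congr fun v => by simp⟩, Or.inl (Nat.zero_le _)⟩
    (fun _ _ ⟨_, _, ⟨_, h⟩, _⟩ => h.matrix.1) ?_ ?_ ?_
  · rintro i s v ⟨P, h1, ⟨k, h2⟩, h3⟩
    exact ⟨P, h1, ⟨v, h2.matrix.setReg (by decide) _, h2.keys, h2.le_one, h2.ne_zero, by simp,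
      by simpa using h2.count⟩, h3⟩
  · rintro i s hi ⟨P, hP, ⟨k, hs⟩, hPi⟩ hsi
    obtain rfl : k = i := hs.round.symm.trans hsi
    refine Halts.seq (halts_select hB hK hs) fun s ⟨hs, h⟩ => ?_
    have hs0 := hs.matrix.1
    have hc := hs.count
    have hcard := P.card_le_univ
    rw [Fintype.card_fin] at hcard
    have h4 : s.reg 4 ≤ (n + 2) ^ 2 := by
      rcases h with ⟨h, -⟩ | ⟨p, -, h, -⟩
      · exact h.le
      · exact h.trans_le (hK p).le
    have heval : (Expr.lt (.reg 4) .keyBound).eval s ≠ 0 ↔ s.reg 4 < (n + 2) ^ 2 := by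
      simp only [Expr.eval, Expr.keyBound_eval hs0, ne_eq, ite_eq_right_iff, one_ne_zero, imp_false, not_not]
    refine Halts.whenever (e := .lt (.reg 4) .keyBound)
      ⟨h4.trans hB, Expr.keyBound_fits hB hs0, by omega⟩ (fun hne => ?_) fun he => ?_
    · have hlt := heval.1 hne
      obtain ⟨p, h5, -, hbp, hmin⟩ := h.resolve_left fun h => by omega
      have hpP : p ∉ P := fun h => hbp ⟨p, h, p, Or.inl rfl, Or.inl rfl⟩
      have hcount : (insert p P).card = P.card + 1 := Finset.card_insert_of_notMem hpP
      have hnext : Selecting G K (fun x => ∃ p ∈ P, Meets G p x) k (insert p P).card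
          (s.setReg 6 (P.card + 1)) :=
        ⟨hs.matrix.setReg (by decide) _, hs.keys, hs.le_one, hs.ne_zero, by simpa using hs.round,
          by simp [hcount]⟩
      refine Halts.seq (Halts.assign (Q := fun s' => s' = s.setReg 6 (P.card + 1))
        (e := .add (.reg 6) (.const 1)) (by simp only [Expr.Fits, Expr.eval]; omega)
        (by simp [Expr.eval, hc])) fun s' hs' => ?_
      subst hs'
      refine (halts_block hB hnext (p := p) (by simpa using h5)).imp fun s hs => ?_
      refine ⟨⟨insert p P, hP.insert hbp hmin, ⟨k, hs.congr fun x => ?_⟩, ?_⟩, hs.round⟩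
      · rw [Finset.exists_mem_insert, or_comm]
      · refine hPi.imp (fun h => by omega) fun h => absurd (h p) hbp
    · have hall : ∀ v, ∃ p ∈ P, Meets G p v := by
        rcases h with ⟨-, h⟩ | ⟨p, -, h, -⟩
        · exact h
        · exact absurd he (heval.2 (h ▸ hK p))
      exact ⟨⟨P, hP, ⟨k, hs⟩, Or.inr hall⟩, hs.round⟩
  · rintro s ⟨P, hP, ⟨k, hs⟩, hPn⟩
    refine ⟨P, hs.count, hP, hPn.elim (fun h x => ?_) id⟩
    -- If every round picked a vertex, all `n` vertices were picked, and each meets itself.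
    have huniv : P = Finset.univ := (Finset.card_eq_iff_eq_univ P).1
      (le_antisymm P.card_le_univ (by simpa using h))
    exact ⟨x, huniv ▸ Finset.mem_univ x, x, Or.inl rfl, Or.inl rfl⟩

/-! ### The complete algorithm and its running time. -/

/-- Compute the independence domination number of a distance-hereditary graph. -/
def Prog.indepDom : Prog :=
  .seq .closeMatrix <| .seq .layer <| .seq .keys <| .seq .greedy (.assign 0 (.reg 6))

theorem halts_indepDom {B : ℕ} (hB : (n + 2) ^ 2 ≤ B) (hG : IsDistanceHereditary G) :
    Halts B (500 * (n + 1) ^ 3) .indepDom (input G) fun s => s.reg 0 = indepDomNumber G := by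
  have hB' := add_two_le_of_sq_le hB
  refine (Halts.seq (halts_closeMatrix hB) fun s ⟨hs, h0⟩ =>
    Halts.seq (halts_layer hB hs fun v => h0 v) fun s ⟨hs, D, hsD, hD, hDn⟩ =>
    Halts.seq (halts_keys hB (fun v => (hDn v).2) hs hsD) fun s ⟨hs, hsK⟩ =>
    Halts.seq (halts_greedy hB (key_lt D) hs hsK) fun s ⟨P, h6, hP, hcov⟩ =>
    Halts.assign (e := .reg 6) ?_ ?_).mono ?_
  · simp only [Expr.cost]
    nlinarith [sq_nonneg n, Nat.zero_le n, Nat.zero_le (n ^ 3)]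
  · have hcard := P.card_le_univ
    rw [Fintype.card_fin] at hcard
    simp only [Expr.Fits]
    omega
  · rw [hD.indepDomNumber_eq_card hG P
      (fun p hp q hq m h1 h2 => hP.disjoint p hp q hq ⟨m, h1, h2⟩) fun x => ?_]
    · simpa [Expr.eval] using h6
    · obtain ⟨p, hp, h1, h2⟩ := hP.le x (hcov x)
      exact ⟨p, hp, precedes_of_key_le (fun v => (hDn v).2) h1, h2⟩

end IndepDom

/-- There is one program, running on random access machines with words of `O(log n)` bits
(words hold numbers up to `(n + 2) ^ k`), that on the adjacency matrix of any
distance-hereditary graph `G` with `n` vertices halts after at most `T n = O(n ^ 3)` steps with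
the independence domination number of `G` in register `0`. -/
theorem mainTheorem4 :
    ∃ (P : IndepDom.Prog) (k : ℕ) (T : ℕ → ℕ),
      (fun n : ℕ => (T n : ℝ)) =O[atTop] (fun n : ℕ => (n : ℝ) ^ 3) ∧
      ∀ (n : ℕ) (G : SimpleGraph (Fin n)), IndepDom.IsDistanceHereditary G →
        ∃ (t : ℕ) (s : IndepDom.State), t ≤ T n ∧
          IndepDom.Prog.Runs ((n + 2) ^ k) P (IndepDom.input G) t s ∧
          s.reg 0 = IndepDom.indepDomNumber G := by
  refine ⟨.indepDom, 2, fun n => 500 * (n + 1) ^ 3, ?_,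
    fun n G hG => IndepDom.halts_indepDom le_rfl hG⟩
  -- The constant is `500 * 2 ^ 3`, from `n + 1 ≤ 2 * n` for `n ≥ 1`.
  refine IsBigO.of_bound 4000 ?_
  filter_upwards [eventually_ge_atTop 1] with n hn
  have hn' : (1 : ℝ) ≤ n := by exact_mod_cast hn
  have h : ((n : ℝ) + 1) ^ 3 ≤ (2 * n) ^ 3 := by gcongr; linarith
  rw [Real.norm_of_nonneg (by positivity), Real.norm_of_nonneg (by positivity)]
  push_cast
  nlinarith [h]
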